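/- A point-line problem in three views consists of finitely many points and lines in space with a prescribed incidence relation $\mathcal I$ (realizable by distinct points and distinct lines in $\mathbb R^3$, and containing every incidence that it implies), together with, for each view $v=1,2,3$, the set of points and the set of lines observed in $v$; if a view observes two lines that meet in a point according to $\mathcal I$, it observes this point. It is a PL1P if each line in space is incident to at most one point. A line through a point is called a pin of that point; a line incident to no point is a free line. All varieties are taken over $\mathbb C$. Let $\mathcal X\subset(\mathbb P^3)^p\times(\mathbb G_{1,3})^l$ be the variety of arrangements of points and lines satisfying (at least) the incidences in $\mathcal I$; let $\mathcal C$ be the variety of triples of calibrated cameras $[R_v\mid t_v]$, $R_v\in \mathrm{SO}(3)$, normalized by $R_1=I$, $t_1=0$, $t_{2,1}=1$; let $\mathcal Y$ be the variety of triples of arrangements in $\mathbb P^2$ of the observed points and lines satisfying, in each view, the incidences in $\mathcal I$ between observed features; and let $\Phi:\mathcal X\times\mathcal C\dashrightarrow\mathcal Y$ be the joint camera map, given by projection. The problem is minimal if, for generic $y\in\mathcal Y$, the preimage $\Phi^{-1}(y)$ is nonempty and finite. Given subsets of the points and lines to be kept, forgetting all other points and lines (in space and in the views) gives a new PL1P with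 joint camera map $\Phi':\mathcal X'\times\mathcal C\dashrightarrow\mathcal Y'$ and forgetting maps $\Pi:\mathcal X\times\mathcal C\to\mathcal X'\times\mathcal C$ and $\pi:\mathcal Y\to\mathcal Y'$. The original problem is reducible to the new one if (i) for each forgotten point at most one of its pins is kept, and (ii) for generic $S'=(X',C)\in\mathcal X'\times\mathcal C$ and generic $y\in\pi^{-1}(\Phi'(S'))$ there is $X\in\mathcal X$ with $\Phi(X,C)=y$ and $\Pi(X,C)=S'$. A PL1P is reduced if it is not reducible to another PL1P, i.e. not by forgetting at least one point or line. Theorem. Consider a reduced minimal PL1P in three views. It has at most one point with three or more pins. If such a point exists, it has at most seven pins, and the point and all its pins are observed in all three views. All other local features are observed, up to permuting the three views, in one of the following ways: - Point with two pins: (a) the point and both pins are observed in all three views; or (b) one view observes the point and both pins, a second view observes only the first pin, and the third view observes only the second pin (for some labeling of the two pins). - Point with one pin: (a) all three views observe the point and the pin; or (b) two views observe the point and the pin, and the third view observes only the pin; or (c) one view observes only the point, one observes the point and the pin, and one observes only the pin; or (d) one view observes only the point, and the other two views observe only the pin. - Point without pins: it is observed in all three views, or in exactly two views. - Free line: it is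 observed in all three views. -/

import Mathlib

/-! Point-line problems with partial visibility.  All varieties are taken over `ℂ`. -/

noncomputable section

namespace PLP

/-! ### Projective points and lines, arrangements, Zariski topology -/

/-- Points of the projective space `ℙ^{n-1}` over `ℂ`. -/
abbrev ProjPoint (n : ℕ) : Type := Projectivization ℂ (Fin n → ℂ)

/-- Lines in `ℙ^{n-1}`: two-dimensional linear subspaces of `ℂ^n` (the Grassmannian `𝔾_{1,n-1}`). -/
abbrev ProjLine (n : ℕ) : Type :=
  {W : Submodule ℂ (Fin n → ℂ) // Module.finrank ℂ W = 2}

/-- The point `x` lies on the line `ℓ`. -/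
def OnLine {n : ℕ} (x : ProjPoint n) (ℓ : ProjLine n) : Prop := x.submodule ≤ ℓ.1

/-- A family of points, indexed by `P`, and of lines, indexed by `L`, in `ℙ^{n-1}`:
an element of `(ℙ^{n-1})^P × (𝔾_{1,n-1})^L`. -/
@[ext] structure Arrangement (n : ℕ) (P L : Type*) where
  point : P → ProjPoint n
  line : L → ProjLine n

/-- Arrangements in which at least the incidences prescribed by `inc` hold. -/
def incidenceVariety (n : ℕ) {P L : Type*} (inc : P → L → Prop) : Set (Arrangement n P L) :=
  {A | ∀ i j, inc i j → OnLine (A.point i) (A.line j)}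

/-- A pinhole camera: a `3 × 4` matrix `[R | t]`. -/
abbrev Camera : Type := Matrix (Fin 3) (Fin 4) ℂ

/-- The left block `R` of `[R | t]`. -/
def Camera.rot (C : Camera) : Matrix (Fin 3) (Fin 3) ℂ := fun a b => C a b.castSucc

/-- The last column `t` of `[R | t]`. -/
def Camera.trans (C : Camera) : Fin 3 → ℂ := fun a => C a (Fin.last 3)

/-- Configurations of `m` calibrated cameras `[R_v | t_v]`, `R_v ∈ SO(3)`, in normalized
coordinates: the first camera is `[I | 0]` and the first entry of the translation of the second
camera is `1`. -/
def cameraConfigs (m : ℕ) : Set (Fin m → Camera) :=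
  {C | (∀ v, (C v).rot * (C v).rot.transpose = 1 ∧ (C v).rot.det = 1) ∧
    (∀ v : Fin m, v.val = 0 → (C v).rot = 1 ∧ (C v).trans = 0) ∧
    (∀ v : Fin m, v.val = 1 → (C v).trans 0 = 1)}

/-- A space arrangement (in `ℙ^3`) together with `m` cameras. -/
@[ext] structure Configuration (P L : Type*) (m : ℕ) where
  arr : Arrangement 4 P L
  cam : Fin m → Camera

/-- The Zariski topology on the affine space `ℂ^ι`. -/
abbrev affineZariski (ι : Type*) : TopologicalSpace (ι → ℂ) :=
  TopologicalSpace.generateFrom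
    {U | ∃ f : MvPolynomial ι ℂ, U = {x | MvPolynomial.eval x f ≠ 0}}

/-- Homogeneous coordinates for an arrangement: a nonzero vector for each point, and a pair of
linearly independent vectors for each line. -/
structure Frame (n : ℕ) (P L : Type*) where
  pt : P → Fin n → ℂ
  ln : L → Fin 2 → Fin n → ℂ
  pt_ne : ∀ i, pt i ≠ 0
  ln_indep : ∀ j, LinearIndependent ℂ (ln j)

/-- The arrangement with given homogeneous coordinates. -/
def Frame.toArrangement {n : ℕ} {P L : Type*} (F : Frame n P L) : Arrangement n P L where
  point i := Projectivization.mk ℂ (F.pt i) (F.pt_ne i)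
  line j := ⟨Submodule.span ℂ (Set.range (F.ln j)), by
    simpa using finrank_span_eq_card (F.ln_indep j)⟩

/-- All the coordinates of a frame, as one vector. -/
def Frame.coord {n : ℕ} {P L : Type*} (F : Frame n P L) :
    (P × Fin n) ⊕ (L × Fin 2 × Fin n) → ℂ :=
  Sum.elim (fun a => F.pt a.1 a.2) (fun b => F.ln b.1 b.2.1 b.2.2)

/-- The Zariski topology on a product of projective spaces and Grassmannians of lines, as the
quotient of the Zariski topology on homogeneous coordinates. -/
instance Arrangement.zariski (n : ℕ) (P L : Type*) : TopologicalSpace (Arrangement n P L) :=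
  TopologicalSpace.coinduced Frame.toArrangement
    (TopologicalSpace.induced Frame.coord (affineZariski _))

/-- The Zariski topology on arrangements with cameras (not the product of two topologies). -/
instance Configuration.zariski (P L : Type*) (m : ℕ) :
    TopologicalSpace (Configuration P L m) :=
  TopologicalSpace.coinduced
    (fun F : Frame 4 P L × (Fin m → Camera) =>
      (⟨F.1.toArrangement, F.2⟩ : Configuration P L m))
    (TopologicalSpace.induced
      (fun F : Frame 4 P L × (Fin m → Camera) =>
        Sum.elim F.1.coord (fun c : Fin m × Fin 3 × Fin 4 => F.2 c.1 c.2.1 c.2.2))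
      (affineZariski _))

/-- `Q` holds for a generic element of `V`, i.e. on a dense (relatively) open subset of `V`. -/
def Generic {A : Type*} [TopologicalSpace A] (V : Set A) (Q : A → Prop) : Prop :=
  ∃ U : Set A, IsOpen U ∧ V ⊆ closure (U ∩ V) ∧ ∀ a ∈ U ∩ V, Q a

/-! ### Point-line problems -/

/-- Distinct points and distinct lines in `ℝ^3` satisfying the incidences `inc`. -/
structure IsRealization {P L : Type*} (inc : P → L → Prop)
    (X : P → EuclideanSpace ℝ (Fin 3))
    (ℓ : L → AffineSubspace ℝ (EuclideanSpace ℝ (Fin 3))) : Prop where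
  point_injective : Function.Injective X
  line_injective : Function.Injective ℓ
  line_nonempty : ∀ j, (ℓ j : Set (EuclideanSpace ℝ (Fin 3))).Nonempty
  line_dim : ∀ j, Module.finrank ℝ (ℓ j).direction = 1
  incident : ∀ i j, inc i j → X i ∈ ℓ j

/-- A point-line problem in `m` views: points `P` and lines `L` in space with prescribed
incidences, and for every view the sets of observed points and lines. -/
structure PointLineProblem (P L : Type*) (m : ℕ) where
  /-- `inc i j`: point `i` is on line `j`. -/
  inc : P → L → Prop
  /-- the points observed in view `v` -/
  obsPt : Fin m → Set P
  /-- the lines observed in view `v` -/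
  obsLn : Fin m → Set L
  realizable : ∃ X ℓ, IsRealization inc X ℓ
  complete : ∀ i j, (∀ X ℓ, IsRealization inc X ℓ → X i ∈ ℓ j) → inc i j
  obs_meet : ∀ v i j k, j ≠ k → inc i j → inc i k → j ∈ obsLn v → k ∈ obsLn v → i ∈ obsPt v

namespace PointLineProblem

variable {P L : Type*} {m : ℕ} (D : PointLineProblem P L m)

/-- Each line in space is incident to at most one point. -/
def IsPL1P : Prop := ∀ i i' j, D.inc i j → D.inc i' j → i = i'

/-- The pins of the point `i`: the lines through it. -/
def pins (i : P) : Set L := {j | D.inc i j}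

/-- A free line is incident to no point. -/
def IsFreeLine (j : L) : Prop := ∀ i, ¬ D.inc i j

/-- Pairs of a view and a point observed in it. -/
abbrev ObsPt : Type _ := {a : Fin m × P // a.2 ∈ D.obsPt a.1}

/-- Pairs of a view and a line observed in it. -/
abbrev ObsLn : Type _ := {b : Fin m × L // b.2 ∈ D.obsLn b.1}

/-- Tuples of points and lines in the image planes `ℙ^2`, one for every observed feature. -/
abbrev Image : Type _ := Arrangement 3 D.ObsPt D.ObsLn

/-- The image variety: in every view, the prescribed incidences hold. -/
def imageVariety : Set D.Image :=
  incidenceVariety 3 (fun (a : D.ObsPt) (b : D.ObsLn) => a.1.1 = b.1.1 ∧ D.inc a.1.2 b.1.2)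

/-- The domain of the joint camera map: space arrangements satisfying the incidences,
together with a normalized configuration of calibrated cameras. -/
def configs : Set (Configuration P L m) :=
  {S | S.arr ∈ incidenceVariety 4 D.inc ∧ S.cam ∈ cameraConfigs m}

/-- The graph of the joint camera map: it is defined at `S` and sends `S` to `y`.
(If a point is the center of a camera, or a line passes through it, then its image subspace has
too small a dimension to be the one underlying a point, respectively a line, of `ℙ^2`.) -/
def MapsTo (S : Configuration P L m) (y : D.Image) : Prop :=
  (∀ a : D.ObsPt, (S.arr.point a.1.2).submodule.map (S.cam a.1.1).mulVecLin
      = (y.point a).submodule) ∧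
  (∀ b : D.ObsLn, (S.arr.line b.1.2).1.map (S.cam b.1.1).mulVecLin = (y.line b).1)

/-- The preimage of `y` under the joint camera map: the solutions for the joint image `y`. -/
def solutions (y : D.Image) : Set (Configuration P L m) :=
  {S | S ∈ D.configs ∧ D.MapsTo S y}

/-- The joint camera map is dominant and its generic fiber is finite. -/
def IsMinimal : Prop :=
  Generic D.imageVariety (fun y => (D.solutions y).Nonempty) ∧
  Generic D.imageVariety (fun y => (D.solutions y).Finite)

/-! ### Forgetting points and lines; reducibility -/

/-- Keep only the points in `P'` and the lines in `L'`, in space and in the views. -/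
def restrict (P' : Set P) (L' : Set L) : PointLineProblem P' L' m where
  inc i j := D.inc i j
  obsPt v := {i | (i : P) ∈ D.obsPt v}
  obsLn v := {j | (j : L) ∈ D.obsLn v}
  realizable := by
    obtain ⟨X, ℓ, h⟩ := D.realizable
    exact ⟨fun i => X i, fun j => ℓ j,
      ⟨fun a b hab => Subtype.ext (h.point_injective hab),
       fun a b hab => Subtype.ext (h.line_injective hab),
       fun j => h.line_nonempty j, fun j => h.line_dim j, fun i j => h.incident i j⟩⟩
  complete i j hij := D.complete i j fun X ℓ h =>
    hij (fun i => X i) (fun j => ℓ j)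
      ⟨fun a b hab => Subtype.ext (h.point_injective hab),
       fun a b hab => Subtype.ext (h.line_injective hab),
       fun j => h.line_nonempty j, fun j => h.line_dim j, fun i j => h.incident i j⟩
  obs_meet v i j k hjk h1 h2 h3 h4 :=
    D.obs_meet v i j k (fun h => hjk (Subtype.ext h)) h1 h2 h3 h4

/-- The forgetting map on space arrangements. -/
def forgetArr (P' : Set P) (L' : Set L) (A : Arrangement 4 P L) : Arrangement 4 P' L' where
  point i := A.point i
  line j := A.line j

/-- The forgetting map on images. -/
def forgetImage (P' : Set P) (L' : Set L) (y : D.Image) : (D.restrict P' L').Image where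
  point a := y.point ⟨(a.1.1, a.1.2.1), a.2⟩
  line b := y.line ⟨(b.1.1, b.1.2.1), b.2⟩

/-- `D` is reducible to its restriction to `P'` and `L'`: each forgotten point keeps at most one
pin, and, for a generic configuration `S'` of the restricted problem and a generic image `y` of
`D` that restricts to the image of `S'`, there is a solution of `D` for `y` with the same cameras
that restricts to `S'`. -/
def ReducibleTo (P' : Set P) (L' : Set L) : Prop :=
  (∀ i, i ∉ P' → ∀ j ∈ L', ∀ k ∈ L', D.inc i j → D.inc i k → j = k) ∧
  Generic (D.restrict P' L').configs (fun S' =>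
    Generic {y | y ∈ D.imageVariety ∧ (D.restrict P' L').MapsTo S' (D.forgetImage P' L' y)}
      (fun y => ∃ A ∈ incidenceVariety 4 D.inc,
        D.MapsTo ⟨A, S'.cam⟩ y ∧ forgetArr P' L' A = S'.arr))

/-- Not reducible to another problem, i.e. by forgetting at least one point or line. -/
def IsReduced : Prop :=
  ∀ (P' : Set P) (L' : Set L), D.ReducibleTo P' L' → P' = Set.univ ∧ L' = Set.univ

end PointLineProblem

/-! ### The table of observed local features

A row lists, for each of three views, what is seen there; rows are read up to a permutation of
the three views. -/

/-- A point without pins: whether the point is seen. -/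
def table0 : List (Fin 3 → Bool) :=
  [![true, true, true],
   ![true, true, false]]

/-- A point with one pin: whether (the point, the pin) is seen. -/
def table1 : List (Fin 3 → Bool × Bool) :=
  [![(true, true), (true, true), (true, true)],
   ![(true, true), (true, true), (false, true)],
   ![(true, false), (true, true), (false, true)],
   ![(true, false), (false, true), (false, true)]]

/-- A point with two pins: whether (the point, the first pin, the second pin) is seen. -/
def table2 : List (Fin 3 → Bool × Bool × Bool) :=
  [![(true, true, true), (true, true, true), (true, true, true)],
   ![(true, true, true), (false, true, false), (false, false, true)]]

end PLP

end

/-! A star, that is, a point together with its pins, is seen in each view in one of a few ways, and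
minimality and reducedness exclude all but those in the table.

*Finiteness.* A line on at most one point which is seen in at most one view can be rotated about a
point in the plane spanned by the line and a camera center, and a point on no line which is seen in
at most one view can be moved along its viewing ray. In both cases the image does not change, so
solutions occur in infinite families (`infinite_solutions_of_line`, `infinite_solutions_of_point`).
In a minimal problem every line, and every point without pins, is therefore seen in two views.

*Reducibility.* A point with a single pin can be forgotten if it is seen at most once, together with
its pin (`reducibleTo_of_point`). A line which is seen in exactly two views can be forgotten if each
point on it is seen in both of them: it is the intersection of the two planes spanned by the image
lines and the camera centers (`reducibleTo_of_line`). This fails only for special configurations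
(coinciding centers, or a point on the baseline) and special images (an image line through the
epipole). That these are nowhere dense is proved by moving along lines in the space of
homogeneous coordinates: a polynomial which does not vanish at some point of such a line vanishes at
finitely many of its points (`mem_closure_of_line`).

These facts and the rule that a view of two pins sees their point imply the table by a case
distinction, and they show that a point with three or more pins is seen in all views together with
all its pins (`seen_of_three_le_ncard_pins`).

*Dominance.* The global bounds are dimension counts. If the joint camera map is dominant, then there
is a solution for an image whose homogeneous coordinates are algebraically independent over some
subfield `k` of `ℂ` (`exists_generic_views`). But these coordinates are algebraic over the numbers
describing the solution, and three normalized cameras have only `11` degrees of freedom. Seen in all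
three views, `q` points with `n` pins in total give `6 q + 3 n` parameters of the image, against
`11 + 3 q + 2 n` of the solution, so `3 q + n ≤ 11` (`card_le_of_views`). Hence there are no two
points with three pins each, and a single point has at most eight pins. To exclude eight, one uses
that the directions of the pins of a finite point are seen by the rotations of the cameras alone,
which have `6` degrees of freedom (`card_le_of_views_of_ne_zero`), while a point at infinity has one
parameter less. -/

noncomputable section

namespace PLP

open Module Matrix

/-! ### Algebraic independence of complex numbers -/

/-- The numbers that are algebraic over the field generated by `k` and `t`. -/
def algSpan (k : Subfield ℂ) (t : Set ℂ) : Subfield ℂ :=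
  { (Subalgebra.algebraicClosure (Algebra.adjoin k t) ℂ).toSubring with
    inv_mem' := fun x hx => by
      have h : IsAlgebraic (Algebra.adjoin k t) x := hx
      exact h.inv }

lemma algSpan_eq_closure (k : Subfield ℂ) (t : Set ℂ) :
    (algSpan k t : Set ℂ) = (AlgebraicIndependent.matroid k ℂ).closure t := by
  rw [AlgebraicIndependent.matroid_closure_eq]; rfl

lemma subset_algSpan (k : Subfield ℂ) (t : Set ℂ) : t ⊆ algSpan k t := fun x hx =>
  isAlgebraic_algebraMap (⟨x, Algebra.subset_adjoin hx⟩ : Algebra.adjoin k t)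

lemma algSpan_mono (k : Subfield ℂ) {s t : Set ℂ} (h : s ⊆ t) : algSpan k s ≤ algSpan k t := by
  intro x hx
  have : x ∈ (algSpan k s : Set ℂ) := hx
  rw [algSpan_eq_closure] at this
  have := (AlgebraicIndependent.matroid k ℂ).closure_subset_closure h this
  rwa [← algSpan_eq_closure] at this

/-- A root of a nonzero quadratic polynomial with coefficients in `algSpan k t` is again there. -/
lemma mem_algSpan_of_quadratic {k : Subfield ℂ} {t : Set ℂ} {a b c x : ℂ}
    (ha : a ∈ algSpan k t) (hb : b ∈ algSpan k t) (hc : c ∈ algSpan k t)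
    (h0 : a ≠ 0 ∨ b ≠ 0 ∨ c ≠ 0) (hx : a * x ^ 2 + b * x + c = 0) : x ∈ algSpan k t := by
  have h1 : IsAlgebraic (algSpan k t) x := by
    refine ⟨Polynomial.C ⟨a, ha⟩ * Polynomial.X ^ 2 + Polynomial.C ⟨b, hb⟩ * Polynomial.X
      + Polynomial.C ⟨c, hc⟩, ?_, ?_⟩
    · intro h
      have e2 := congrArg (fun p => p.coeff 2) h
      have e1 := congrArg (fun p => p.coeff 1) h
      have e0 := congrArg (fun p => p.coeff 0) h
      simp [Polynomial.coeff_X, Polynomial.coeff_C] at e0 e1 e2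
      simp only [Subtype.ext_iff] at e0 e1 e2
      rcases h0 with h | h | h
      exacts [h e2, h e1, h e0]
    · simpa [Algebra.algebraMap_eq_smul_one, Subfield.smul_def] using hx
  have hflat := (AlgebraicIndependent.matroid k ℂ).isFlat_closure t
  rw [AlgebraicIndependent.matroid_isFlat_iff, ← algSpan_eq_closure] at hflat
  obtain ⟨S, hS, hflat⟩ := hflat
  refine hflat x ?_
  obtain ⟨p, hp, hpx⟩ := h1
  have hSm : ∀ y, y ∈ algSpan k t → y ∈ S := fun y hy => by
    have : y ∈ (S : Set ℂ) := by rw [hS]; exact hy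
    exact this
  let φ : algSpan k t →+* S :=
    { toFun := fun y => ⟨y.1, hSm _ y.2⟩, map_one' := rfl, map_mul' := fun _ _ => rfl,
      map_zero' := rfl, map_add' := fun _ _ => rfl }
  refine ⟨p.map φ, (Polynomial.map_ne_zero_iff φ.injective).2 hp, ?_⟩
  rw [← hpx, Polynomial.aeval_def, Polynomial.eval₂_map, Polynomial.aeval_def]
  rfl

/-- There are at most as many algebraically independent numbers as generators of a field over which
they are algebraic. -/
lemma card_le_of_algebraicIndependent {k : Subfield ℂ} {ι κ : Type*} [Fintype ι] [Fintype κ]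
    {z : ι → ℂ} (hz : AlgebraicIndependent k z) (g : κ → ℂ)
    (h : ∀ i, z i ∈ algSpan k (Set.range g)) : Fintype.card ι ≤ Fintype.card κ := by
  have hind : (AlgebraicIndependent.matroid k ℂ).Indep (Set.range z) :=
    (AlgebraicIndependent.matroid_indep_iff).2 hz.coe_range
  have h1 : Set.range z ⊆ (AlgebraicIndependent.matroid k ℂ).closure (Set.range g) := by
    rintro _ ⟨i, rfl⟩
    rw [← algSpan_eq_closure]; exact h i
  have h2 := hind.encard_le_eRk_of_subset h1
  rw [Matroid.eRk_closure_eq] at h2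
  have h3 := h2.trans (Matroid.eRk_le_encard _ _)
  rw [← Set.image_univ, hz.injective.encard_image, Set.encard_univ] at h3
  have h4 := h3.trans ((Set.image_univ (f := g) ▸ Set.encard_image_le g Set.univ))
  rw [Set.encard_univ, ENat.card_eq_coe_fintype_card, ENat.card_eq_coe_fintype_card] at h4
  exact_mod_cast h4

/-- Over a countable field there are arbitrarily large finite families of algebraically
independent complex numbers. -/
lemma exists_algebraicIndependent (k : Subfield ℂ) (hk : Cardinal.mk k ≤ Cardinal.aleph0)
    (ι : Type*) [Finite ι] : ∃ z : ι → ℂ, AlgebraicIndependent k z := by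
  obtain ⟨s, hs⟩ := exists_isTranscendenceBasis k ℂ
  have h := IsAlgClosed.cardinal_eq_cardinal_transcendence_basis_of_aleph0_lt _ hs hk
    (by rw [Cardinal.mk_complex]; exact Cardinal.aleph0_lt_continuum)
  have hinf : Infinite s := by
    rw [Cardinal.infinite_iff]
    simp only [Cardinal.lift_id] at h
    rw [← h, Cardinal.mk_complex]; exact Cardinal.aleph0_le_continuum
  have := Fintype.ofFinite ι
  let e : ι ↪ s := (Fintype.equivFin ι).toEmbedding.trans
    (Fin.valEmbedding.trans (Infinite.natEmbedding s))
  exact ⟨_, hs.1.comp e e.injective⟩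

/-- A polynomial nonvanishing condition can be met by a point whose coordinates are algebraically
independent over some subfield of `ℂ`. -/
lemma exists_algebraicIndependent_eval_ne_zero {ι : Type*} [Finite ι] {f : MvPolynomial ι ℂ}
    (hf : f ≠ 0) :
    ∃ (k : Subfield ℂ) (z : ι → ℂ), AlgebraicIndependent k z ∧ MvPolynomial.eval z f ≠ 0 := by
  let k : Subfield ℂ := Subfield.closure (f.coeffs : Set ℂ)
  have hk : Cardinal.mk k ≤ Cardinal.aleph0 := by
    refine (Subfield.cardinalMk_closure_le_max _).trans (max_le ?_ le_rfl)
    exact Cardinal.mk_le_aleph0_iff.2 (Set.countable_coe_iff.2 f.coeffs.countable_toSet)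
  obtain ⟨z, hz⟩ := exists_algebraicIndependent k hk ι
  refine ⟨k, z, hz, ?_⟩
  have hr : f ∈ Set.range (MvPolynomial.map (algebraMap k ℂ)) := by
    rw [MvPolynomial.mem_range_map_iff_coeffs_subset]
    intro c hc
    exact ⟨⟨c, Subfield.subset_closure hc⟩, rfl⟩
  obtain ⟨f', hf'⟩ := hr
  intro h0
  apply hf
  have h1 : MvPolynomial.aeval z f' = 0 := by
    rw [← h0, ← hf', MvPolynomial.eval_map, MvPolynomial.aeval_def]
  rw [← hf', hz.eq_zero_of_aeval_eq_zero f' h1]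
  simp

/-! ### The transcendence degree of an orthogonal matrix -/

lemma mem_algSpan_of_sq {k : Subfield ℂ} {t : Set ℂ} {c x : ℂ} (hc : c ∈ algSpan k t)
    (hx : x ^ 2 = c) : x ∈ algSpan k t :=
  mem_algSpan_of_quadratic (one_mem _) (zero_mem _) (neg_mem hc) (Or.inl one_ne_zero)
    (by linear_combination hx)

/-- Of two unit vectors that are orthogonal, the second is determined up to finitely many choices
by the first and by one more number. -/
lemma exists_mem_algSpan_of_orthonormal {k : Subfield ℂ} {t : Set ℂ} {a b c d e f : ℂ}
    (ha : a ∈ algSpan k t) (hb : b ∈ algSpan k t) (hc : c ∈ algSpan k t) (ha0 : a ≠ 0)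
    (h1 : a * d + b * e + c * f = 0) (h2 : d ^ 2 + e ^ 2 + f ^ 2 = 1) :
    ∃ x : ℂ, d ∈ algSpan k (insert x t) ∧ e ∈ algSpan k (insert x t) ∧
      f ∈ algSpan k (insert x t) := by
  have hmono : ∀ x, algSpan k t ≤ algSpan k (insert x t) :=
    fun x => algSpan_mono k (Set.subset_insert x t)
  have hself : ∀ x, x ∈ algSpan k (insert x t) :=
    fun x => subset_algSpan k _ (Set.mem_insert x t)
  -- eliminating `d` leaves one equation for `e` and `f`, with a nonzero constant term
  have key : (a ^ 2 + c ^ 2) * f ^ 2 + 2 * b * c * e * f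
      + ((a ^ 2 + b ^ 2) * e ^ 2 - a ^ 2) = 0 := by
    have : a * d = -(b * e + c * f) := by linear_combination h1
    have h3 : (a * d) ^ 2 + a ^ 2 * e ^ 2 + a ^ 2 * f ^ 2 = a ^ 2 := by
      linear_combination a ^ 2 * h2
    rw [this] at h3
    linear_combination h3
  have hd : d = -(b * e + c * f) / a := by
    field_simp; linear_combination h1
  have two : ∀ x, (2 : ℂ) ∈ algSpan k (insert x t) := fun x => ofNat_mem _ 2
  by_cases he : e ∈ algSpan k t
  · refine ⟨f, ?_, hmono _ he, hself _⟩
    rw [hd]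
    exact div_mem (neg_mem (add_mem (mul_mem (hmono _ hb) (hmono _ he))
      (mul_mem (hmono _ hc) (hself _)))) (hmono _ ha)
  · have hf : f ∈ algSpan k (insert e t) := by
      refine mem_algSpan_of_quadratic
        (add_mem (pow_mem (hmono _ ha) 2) (pow_mem (hmono _ hc) 2))
        (mul_mem (mul_mem (mul_mem (two _) (hmono _ hb)) (hmono _ hc)) (hself _))
        (sub_mem (mul_mem (add_mem (pow_mem (hmono _ ha) 2) (pow_mem (hmono _ hb) 2))
          (pow_mem (hself _) 2)) (pow_mem (hmono _ ha) 2)) ?_ key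
      by_contra! hcon
      refine he (mem_algSpan_of_quadratic (add_mem (pow_mem ha 2) (pow_mem hb 2)) (zero_mem _)
        (neg_mem (pow_mem ha 2)) (Or.inr (Or.inr (neg_ne_zero.2 (pow_ne_zero 2 ha0)))) ?_)
      linear_combination hcon.2.2
    refine ⟨e, ?_, hself _, hf⟩
    rw [hd]
    exact div_mem (neg_mem (add_mem (mul_mem (hmono _ hb) (hself _))
      (mul_mem (hmono _ hc) hf))) (hmono _ ha)

/-- The entries of an orthogonal `3 × 3` matrix have transcendence degree at most three. -/
lemma exists_orthogonal_mem_algSpan (k : Subfield ℂ) {R : Matrix (Fin 3) (Fin 3) ℂ}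
    (hR : R * R.transpose = 1) :
    ∃ g : Fin 3 → ℂ, ∀ a b, R a b ∈ algSpan k (Set.range g) := by
  have hR' : R.transpose * R = 1 := mul_eq_one_comm.1 hR
  have row : ∀ a b, R a 0 * R b 0 + R a 1 * R b 1 + R a 2 * R b 2 = if a = b then 1 else 0 := by
    intro a b
    have := congrFun (congrFun hR a) b
    simpa [Matrix.mul_apply, Fin.sum_univ_three, Matrix.one_apply] using this
  have col : ∀ a, R 0 a * R 0 a + R 1 a * R 1 a + R 2 a * R 2 a = 1 := by
    intro a
    have := congrFun (congrFun hR' a) a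
    simpa [Matrix.mul_apply, Fin.sum_univ_three, Matrix.one_apply] using this
  have r00 : R 0 0 * R 0 0 + R 0 1 * R 0 1 + R 0 2 * R 0 2 = 1 := by simpa using row 0 0
  have r11 : R 1 0 * R 1 0 + R 1 1 * R 1 1 + R 1 2 * R 1 2 = 1 := by simpa using row 1 1
  have r01 : R 0 0 * R 1 0 + R 0 1 * R 1 1 + R 0 2 * R 1 2 = 0 := by simpa using row 0 1
  have h0 : ∀ b, R 0 b ∈ algSpan k {R 0 0, R 0 1} := by
    have m0 : R 0 0 ∈ algSpan k {R 0 0, R 0 1} := subset_algSpan k _ (by simp)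
    have m1 : R 0 1 ∈ algSpan k {R 0 0, R 0 1} := subset_algSpan k _ (by simp)
    have m2 : R 0 2 ∈ algSpan k {R 0 0, R 0 1} :=
      mem_algSpan_of_sq (sub_mem (sub_mem (one_mem _) (mul_mem m0 m0)) (mul_mem m1 m1))
        (by linear_combination r00)
    intro b
    fin_cases b
    exacts [m0, m1, m2]
  have h1 : ∃ x, ∀ b, R 1 b ∈ algSpan k (insert x {R 0 0, R 0 1}) := by
    by_cases ha : R 0 0 = 0
    · by_cases hb : R 0 1 = 0
      · have hc : R 0 2 ≠ 0 := fun hc => by simp [ha, hb, hc] at r00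
        obtain ⟨x, hx⟩ := exists_mem_algSpan_of_orthonormal (k := k) (d := R 1 2) (e := R 1 0)
          (f := R 1 1) (h0 2) (h0 0) (h0 1) hc (by linear_combination r01)
          (by linear_combination r11)
        exact ⟨x, fun b => by fin_cases b; exacts [hx.2.1, hx.2.2, hx.1]⟩
      · obtain ⟨x, hx⟩ := exists_mem_algSpan_of_orthonormal (k := k) (d := R 1 1) (e := R 1 0)
          (f := R 1 2) (h0 1) (h0 0) (h0 2) hb (by linear_combination r01)
          (by linear_combination r11)
        exact ⟨x, fun b => by fin_cases b; exacts [hx.2.1, hx.1, hx.2.2]⟩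
    · obtain ⟨x, hx⟩ := exists_mem_algSpan_of_orthonormal (k := k) (d := R 1 0) (e := R 1 1)
          (f := R 1 2) (h0 0) (h0 1) (h0 2) ha (by linear_combination r01)
          (by linear_combination r11)
      exact ⟨x, fun b => by fin_cases b; exacts [hx.1, hx.2.1, hx.2.2]⟩
  obtain ⟨x, hx⟩ := h1
  refine ⟨![x, R 0 0, R 0 1], ?_⟩
  have hr : Set.range ![x, R 0 0, R 0 1] = insert x {R 0 0, R 0 1} := by
    ext y; simp; tauto
  rw [hr]
  have h0' : ∀ b, R 0 b ∈ algSpan k (insert x {R 0 0, R 0 1}) :=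
    fun b => algSpan_mono k (Set.subset_insert _ _) (h0 b)
  have h2 : ∀ b, R 2 b ∈ algSpan k (insert x {R 0 0, R 0 1}) := fun b =>
    mem_algSpan_of_sq (sub_mem (sub_mem (one_mem _) (mul_mem (h0' b) (h0' b)))
      (mul_mem (hx b) (hx b))) (by linear_combination col b)
  intro a b
  fin_cases a
  exacts [h0' b, hx b, h2 b]

/-! ### The Zariski topology on homogeneous coordinates -/

lemma exists_eval_ne_zero_of_isOpen {ι : Type*} {U : Set (ι → ℂ)}
    (hU : @IsOpen _ (affineZariski ι) U) {x : ι → ℂ} (hx : x ∈ U) :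
    ∃ f : MvPolynomial ι ℂ, MvPolynomial.eval x f ≠ 0 ∧
      ∀ y, MvPolynomial.eval y f ≠ 0 → y ∈ U := by
  have hU' : TopologicalSpace.GenerateOpen
    {U | ∃ f : MvPolynomial ι ℂ, U = {x | MvPolynomial.eval x f ≠ 0}} U := hU
  induction hU' with
  | basic s hs =>
    obtain ⟨f, rfl⟩ := hs
    exact ⟨f, hx, fun y hy => hy⟩
  | univ => exact ⟨1, by simp, fun _ _ => trivial⟩
  | inter s t hs ht ihs iht =>
    obtain ⟨f, hf, hf'⟩ := ihs hs hx.1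
    obtain ⟨g, hg, hg'⟩ := iht ht hx.2
    refine ⟨f * g, by simp [hf, hg], fun y hy => ?_⟩
    rw [map_mul] at hy
    exact ⟨hf' y (left_ne_zero_of_mul hy), hg' y (right_ne_zero_of_mul hy)⟩
  | sUnion S hS ih =>
    obtain ⟨s, hs, hxs⟩ := hx
    obtain ⟨f, hf, hf'⟩ := ih s hs (hS s hs) hxs
    exact ⟨f, hf, fun y hy => ⟨s, hs, hf' y hy⟩⟩

/-- Openness in a space whose topology comes, through the quotient map `q`, from a Zariski topology
on coordinates `c`. -/
lemma isOpen_coinduced_zariski_iff {X Y ι : Type*} (q : X → Y) (c : X → ι → ℂ) (U : Set Y) :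
    @IsOpen _ (TopologicalSpace.coinduced q (TopologicalSpace.induced c (affineZariski ι))) U ↔
    ∀ x, q x ∈ U → ∃ f : MvPolynomial ι ℂ, MvPolynomial.eval (c x) f ≠ 0 ∧
      ∀ x', MvPolynomial.eval (c x') f ≠ 0 → q x' ∈ U := by
  let _ := affineZariski ι
  constructor
  · intro hU x hx
    obtain ⟨O, hO, hOU⟩ := hU
    have hxO : x ∈ c ⁻¹' O := by rw [hOU]; exact hx
    obtain ⟨f, hf, hf'⟩ := exists_eval_ne_zero_of_isOpen hO hxO
    refine ⟨f, hf, fun x' hx' => ?_⟩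
    have : x' ∈ c ⁻¹' O := hf' _ hx'
    rw [hOU] at this; exact this
  · intro h
    choose! f hf hf' using h
    refine ⟨⋃ x ∈ q ⁻¹' U, {y | MvPolynomial.eval y (f x) ≠ 0}, ?_, ?_⟩
    · exact isOpen_biUnion fun x _ => TopologicalSpace.isOpen_generateFrom_of_mem ⟨f x, rfl⟩
    · ext x'
      simp only [Set.mem_preimage, Set.mem_iUnion]
      constructor
      · rintro ⟨x, hx, hx'⟩
        exact hf' x hx x' hx'
      · exact fun hx' => ⟨x', hx', hf x' hx'⟩

/-- A polynomial that does not vanish identically on a line vanishes at finitely many of its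
points. -/
lemma finite_zeros_on_line {ι : Type*} (f : MvPolynomial ι ℂ) (z d : ι → ℂ) (s₁ : ℂ)
    (h : MvPolynomial.eval (z + s₁ • d) f ≠ 0) :
    {s : ℂ | MvPolynomial.eval (z + s • d) f = 0}.Finite := by
  let p : Polynomial ℂ := MvPolynomial.aeval
    (fun i => Polynomial.C (z i) + Polynomial.X * Polynomial.C (d i)) f
  have hp : ∀ s, p.eval s = MvPolynomial.eval (z + s • d) f := by
    intro s
    have := MvPolynomial.comp_aeval_apply (Polynomial.aeval s : Polynomial ℂ →ₐ[ℂ] ℂ)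
      (f := fun i => Polynomial.C (z i) + Polynomial.X * Polynomial.C (d i)) f
    rw [← Polynomial.coe_aeval_eq_eval]
    show Polynomial.aeval s p = _
    rw [this, MvPolynomial.aeval_eq_eval]
    refine congrArg (fun v => MvPolynomial.eval v f) (funext fun i => ?_)
    simp only [map_add, map_mul, Polynomial.aeval_C, Polynomial.aeval_X, Pi.add_apply,
      Pi.smul_apply, smul_eq_mul]
    simp
  have hp0 : p ≠ 0 := fun h0 => h (by rw [← hp, h0, Polynomial.eval_zero])
  refine (p.rootSet ℂ).toFinite.subset fun s hs => ?_
  rw [Polynomial.mem_rootSet]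
  refine ⟨hp0, ?_⟩
  rw [Polynomial.coe_aeval_eq_eval, hp]; exact hs

/-- If almost all points of a line in the space of coordinates represent elements of `W`, then all
its points represent elements of the closure of `W`. -/
lemma mem_closure_of_line {X Y ι : Type*} {q : X → Y} {c : X → ι → ℂ} [t : TopologicalSpace Y]
    (ht : t = TopologicalSpace.coinduced q (TopologicalSpace.induced c (affineZariski ι)))
    {W : Set Y} (x : X) (d : ι → ℂ)
    (h : {s : ℂ | ¬ ∃ x', c x' = c x + s • d ∧ q x' ∈ W}.Finite) : q x ∈ closure W := by
  rw [mem_closure_iff]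
  intro O hO hx
  rw [ht, isOpen_coinduced_zariski_iff] at hO
  obtain ⟨f, hf, hf'⟩ := hO x hx
  have h2 := finite_zeros_on_line f (c x) d 0 (by simpa using hf)
  obtain ⟨s, hs⟩ := (h.union h2).infinite_compl.nonempty
  simp only [Set.mem_compl_iff, Set.mem_union, Set.mem_ofPred_eq, not_or, not_not] at hs
  obtain ⟨⟨x', hx', hW⟩, hs⟩ := hs
  exact ⟨q x', hf' x' (by rw [hx']; exact hs), hW⟩

lemma Generic.exists_and {A : Type*} [TopologicalSpace A] {V : Set A} {Q Q' : A → Prop}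
    (h : Generic V Q) (h' : Generic V Q') (hV : V.Nonempty) : ∃ a ∈ V, Q a ∧ Q' a := by
  obtain ⟨U, hU, hd, hQ⟩ := h
  obtain ⟨U', hU', hd', hQ'⟩ := h'
  obtain ⟨a, ha⟩ := hV
  obtain ⟨b, hb⟩ := closure_nonempty_iff.1 ⟨a, hd ha⟩
  obtain ⟨c, hc⟩ := mem_closure_iff.1 (hd' hb.2) U hU hb.1
  exact ⟨c, hc.2.2, hQ c ⟨hc.1, hc.2.2⟩, hQ' c hc.2⟩

/-! ### Frames of lines -/

lemma span_pair_eq {n : ℕ} (f : Fin 2 → Fin n → ℂ) :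
    Submodule.span ℂ (Set.range f) = Submodule.span ℂ {f 0, f 1} := by
  congr 1
  ext y; simp [eq_comm]

lemma eq_span_pair {n : ℕ} {W : Submodule ℂ (Fin n → ℂ)} (hW : finrank ℂ W = 2)
    {x w : Fin n → ℂ} (hx : x ∈ W) (hw : w ∈ W) (h : LinearIndependent ℂ ![x, w]) :
    W = Submodule.span ℂ {x, w} := by
  have h1 : Submodule.span ℂ (Set.range ![x, w]) = W := by
    refine Submodule.eq_of_le_of_finrank_eq (Submodule.span_le.2 ?_) ?_
    · rintro _ ⟨i, rfl⟩
      fin_cases i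
      exacts [hx, hw]
    · rw [finrank_span_eq_card h, hW]; simp
  rw [← h1, span_pair_eq]; rfl

lemma exists_pair_of_mem {n : ℕ} {W : Submodule ℂ (Fin n → ℂ)} (hW : finrank ℂ W = 2)
    {x : Fin n → ℂ} (hx : x ∈ W) (hx0 : x ≠ 0) :
    ∃ w ∈ W, LinearIndependent ℂ ![x, w] ∧ W = Submodule.span ℂ {x, w} := by
  have h : ¬ W ≤ Submodule.span ℂ {x} := fun h => by
    have := Submodule.finrank_mono h
    rw [hW, finrank_span_singleton hx0] at this
    omega
  obtain ⟨w, hw, hwx⟩ := SetLike.not_le_iff_exists.1 h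
  have hi : LinearIndependent ℂ ![x, w] := by
    rw [LinearIndependent.pair_iff' hx0]
    exact fun a ha => hwx (Submodule.mem_span_singleton.2 ⟨a, ha⟩)
  exact ⟨w, hw, hi, eq_span_pair hW hx hw hi⟩

lemma exists_ne_zero_mem {n : ℕ} {W : Submodule ℂ (Fin n → ℂ)} (hW : finrank ℂ W = 2) :
    ∃ x ∈ W, x ≠ 0 := by
  have : W ≠ ⊥ := fun h => by rw [h] at hW; simp at hW
  exact Submodule.exists_mem_ne_zero_of_ne_bot this

lemma rep_mem {n : ℕ} (x : ProjPoint n) : x.rep ∈ x.submodule := by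
  rw [Projectivization.submodule_eq]; exact Submodule.mem_span_singleton_self _

lemma onLine_iff {n : ℕ} {x : ProjPoint n} {ℓ : ProjLine n} : OnLine x ℓ ↔ x.rep ∈ ℓ.1 := by
  rw [OnLine, Projectivization.submodule_eq, Submodule.span_singleton_le_iff_mem]

/-- The line spanned by two independent vectors. -/
def lineThrough {n : ℕ} (x w : Fin n → ℂ) (h : LinearIndependent ℂ ![x, w]) : ProjLine n :=
  ⟨Submodule.span ℂ {x, w}, by
    have := finrank_span_eq_card h
    rw [span_pair_eq] at this
    exact this.trans (by simp)⟩

/-- If every line is incident to at most one point, then an arrangement has homogeneous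
coordinates in which a line through a prescribed point is spanned by that point and a second
vector. -/
lemma exists_adapted_frame {n : ℕ} {P L : Type*} {inc : P → L → Prop}
    (hinc : ∀ i i' j, inc i j → inc i' j → i = i') {A : Arrangement n P L}
    (hA : A ∈ incidenceVariety n inc) :
    ∃ F : Frame n P L, F.toArrangement = A ∧ ∀ i j, inc i j → F.ln j 0 = F.pt i := by
  have h1 : ∀ j, ∃ x ∈ (A.line j).1, x ≠ 0 ∧ ∀ i, inc i j → x = (A.point i).rep := by
    intro j
    by_cases h : ∃ i, inc i j
    · obtain ⟨i, hi⟩ := h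
      exact ⟨_, onLine_iff.1 (hA i j hi), (A.point i).rep_nonzero,
        fun i' hi' => by rw [hinc i i' j hi hi']⟩
    · obtain ⟨x, hx, hx0⟩ := exists_ne_zero_mem (A.line j).2
      exact ⟨x, hx, hx0, fun i hi => absurd ⟨i, hi⟩ h⟩
  choose x hx hx0 hxi using h1
  choose w hw hi hs using fun j => exists_pair_of_mem (A.line j).2 (hx j) (hx0 j)
  refine ⟨⟨fun i => (A.point i).rep, fun j => ![x j, w j], fun i => (A.point i).rep_nonzero,
    hi⟩, ?_, fun i j hij => hxi j i hij⟩
  ext1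
  · funext i
    exact Projectivization.mk_rep _
  · funext j
    apply Subtype.ext
    show Submodule.span ℂ (Set.range ![x j, w j]) = _
    rw [span_pair_eq, hs j]; rfl

/-! ### Cameras -/

lemma Camera.mulVec_eq (C : Camera) (X : Fin 4 → ℂ) :
    C *ᵥ X = C.rot *ᵥ (fun a => X a.castSucc) + X (Fin.last 3) • C.trans := by
  ext a
  simp [Matrix.mulVec, dotProduct, Fin.sum_univ_castSucc, Camera.rot, Camera.trans, mul_comm]

lemma Camera.exists_ker (C : Camera) : ∃ c : Fin 4 → ℂ, c ≠ 0 ∧ C *ᵥ c = 0 := by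
  have := LinearMap.ker_ne_bot_of_finrank_lt (f := C.mulVecLin) (by simp)
  obtain ⟨c, hc, hc0⟩ := Submodule.exists_mem_ne_zero_of_ne_bot this
  exact ⟨c, hc0, hc⟩

/-- The center of a camera `[R | t]` with `R` orthogonal, in homogeneous coordinates. -/
def Camera.center (C : Camera) : Fin 4 → ℂ := Fin.snoc (-(C.rot.transpose *ᵥ C.trans)) 1

lemma Camera.center_castSucc (C : Camera) (a : Fin 3) :
    C.center a.castSucc = -(C.rot.transpose *ᵥ C.trans) a := by
  simp [Camera.center]

lemma Camera.center_last (C : Camera) : C.center (Fin.last 3) = 1 := by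
  rw [Camera.center, Fin.snoc_last]

lemma Camera.mulVec_center {C : Camera} (hC : C.rot * C.rot.transpose = 1) :
    C *ᵥ C.center = 0 := by
  have h : (fun a : Fin 3 => C.center a.castSucc) = -(C.rot.transpose *ᵥ C.trans) :=
    funext C.center_castSucc
  rw [Camera.mulVec_eq, h, C.center_last]
  simp [Matrix.mulVec_neg, hC]

lemma Camera.center_ne_zero (C : Camera) : C.center ≠ 0 := fun h => by
  have := congrFun h (Fin.last 3)
  rw [C.center_last] at this
  exact one_ne_zero this

lemma Camera.eq_smul_center {C : Camera} (hC : C.rot * C.rot.transpose = 1) {X : Fin 4 → ℂ}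
    (h : C *ᵥ X = 0) : X = X (Fin.last 3) • C.center := by
  have hC' : C.rot.transpose * C.rot = 1 := mul_eq_one_comm.1 hC
  rw [Camera.mulVec_eq] at h
  have h1 := congrArg (fun v => C.rot.transpose *ᵥ v) h
  simp only [Matrix.mulVec_add, Matrix.mulVec_mulVec, hC', Matrix.one_mulVec, Matrix.mulVec_smul,
    Matrix.mulVec_zero] at h1
  ext a
  refine Fin.lastCases ?_ (fun b => ?_) a
  · rw [Pi.smul_apply, C.center_last, smul_eq_mul, mul_one]
  · have := congrFun h1 b
    simp only [Pi.add_apply, Pi.smul_apply, Pi.zero_apply, smul_eq_mul] at this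
    rw [Pi.smul_apply, C.center_castSucc, smul_eq_mul]
    linear_combination this

lemma Camera.exists_mulVec_eq {C : Camera} (hC : C.rot * C.rot.transpose = 1) (u : Fin 3 → ℂ) :
    ∃ X : Fin 4 → ℂ, C *ᵥ X = u := by
  refine ⟨Fin.snoc (C.rot.transpose *ᵥ u) 0, ?_⟩
  have h : (fun a : Fin 3 => (Fin.snoc (C.rot.transpose *ᵥ u) 0 : Fin 4 → ℂ) a.castSucc)
      = C.rot.transpose *ᵥ u := funext fun a => by simp
  rw [Camera.mulVec_eq, h, Fin.snoc_last]
  simp [hC]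

/-- A subspace which is mapped onto one of the same dimension meets the kernel trivially. -/
lemma eq_zero_of_map_finrank_eq {n m : ℕ} {W : Submodule ℂ (Fin n → ℂ)}
    (f : (Fin n → ℂ) →ₗ[ℂ] (Fin m → ℂ)) (h : finrank ℂ (W.map f) = finrank ℂ W)
    {c : Fin n → ℂ} (hc : c ∈ W) (hfc : f c = 0) : c = 0 := by
  have h1 := LinearMap.finrank_range_add_finrank_ker (f.domRestrict W)
  rw [LinearMap.range_domRestrict, h] at h1
  have h2 : LinearMap.ker (f.domRestrict W) = ⊥ := Submodule.finrank_eq_zero.1 (by omega)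
  have h3 : (⟨c, hc⟩ : W) ∈ LinearMap.ker (f.domRestrict W) := by simpa using hfc
  rw [h2] at h3
  simpa using h3

/-! ### Infinitely many solutions -/

namespace PointLineProblem

variable {P L : Type*} {m : ℕ} (D : PointLineProblem P L m)

variable {D} in
lemma IsPL1P.imageInc (hD : D.IsPL1P) : ∀ (a a' : D.ObsPt) (b : D.ObsLn),
    (a.1.1 = b.1.1 ∧ D.inc a.1.2 b.1.2) → (a'.1.1 = b.1.1 ∧ D.inc a'.1.2 b.1.2) → a = a' :=
  fun _ _ _ h h' => Subtype.ext (Prod.ext (h.1.trans h'.1.symm) (hD _ _ _ h.2 h'.2))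

lemma imageVariety_nonempty : D.imageVariety.Nonempty := by
  have h : LinearIndependent ℂ ![(Pi.single 0 1 : Fin 3 → ℂ), Pi.single 1 1] := by
    rw [LinearIndependent.pair_iff]
    intro s t hst
    have h0 := congrFun hst 0
    have h1 := congrFun hst 1
    simp at h0 h1
    exact ⟨h0, h1⟩
  refine ⟨⟨fun _ => Projectivization.mk ℂ (Pi.single 0 1) (by simp),
    fun _ => lineThrough _ _ h⟩, fun _ _ _ => ?_⟩
  show Projectivization.submodule _ ≤ Submodule.span ℂ _
  rw [Projectivization.submodule_mk]
  exact Submodule.span_mono (by simp)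

/-- A line which is seen in at most one view can be rotated about a point without changing
its image. -/
lemma infinite_solutions_of_line (hD : D.IsPL1P) {y : D.Image} (hy : (D.solutions y).Nonempty)
    (j : L) (v₀ : Fin m) (hj : ∀ v, j ∈ D.obsLn v → v = v₀) : (D.solutions y).Infinite := by
  classical
  obtain ⟨S, hS, hSp, hSl⟩ := hy
  obtain ⟨F, hF, hFi⟩ := exists_adapted_frame hD hS.1
  set x := F.ln j 0 with hx
  set w := F.ln j 1 with hw
  have hxw : LinearIndependent ℂ ![x, w] := by
    convert F.ln_indep j using 1
    ext a; fin_cases a <;> rfl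
  have hW : (S.arr.line j).1 = Submodule.span ℂ {x, w} := by
    rw [← hF]; exact span_pair_eq _
  -- the direction in which the line is moved: the camera center, if the line is seen at all
  obtain ⟨c, hc, hcv⟩ : ∃ c : Fin 4 → ℂ, c ∉ Submodule.span ℂ {x, w} ∧
      (j ∈ D.obsLn v₀ → S.cam v₀ *ᵥ c = 0) := by
    by_cases h : j ∈ D.obsLn v₀
    · obtain ⟨c, hc0, hc⟩ := (S.cam v₀).exists_ker
      refine ⟨c, fun hcW => hc0 ?_, fun _ => hc⟩
      rw [← hW] at hcW
      refine eq_zero_of_map_finrank_eq (S.cam v₀).mulVecLin ?_ hcW hc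
      rw [hSl ⟨(v₀, j), h⟩, (y.line _).2, (S.arr.line j).2]
    · have : Submodule.span ℂ {x, w} ≠ ⊤ := fun h' => by
        have := (S.arr.line j).2
        rw [hW, h'] at this
        simp at this
      obtain ⟨c, -, hc⟩ := SetLike.exists_of_lt this.lt_top
      exact ⟨c, hc, fun h' => absurd h' h⟩
  have hxs : ∀ s : ℂ, LinearIndependent ℂ ![x, w + s • c] := by
    intro s
    rw [LinearIndependent.pair_iff] at hxw ⊢
    intro a b hab
    have hbs : b * s = 0 := by
      by_contra hbs
      refine hc (Submodule.mem_span_pair.2 ⟨-(b * s)⁻¹ * a, -(b * s)⁻¹ * b, ?_⟩)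
      have : a • x + b • w = -(b * s) • c := by
        rw [neg_smul, mul_smul, eq_neg_iff_add_eq_zero, ← hab, smul_add, add_assoc]
      rw [mul_smul, mul_smul, ← smul_add, this, smul_smul, neg_mul_neg, inv_mul_cancel₀ hbs,
        one_smul]
    refine hxw a b ?_
    rw [← hab, smul_add, smul_smul, hbs, zero_smul, add_zero]
  let f : ℂ → Configuration P L m := fun s =>
    ⟨⟨S.arr.point, Function.update S.arr.line j (lineThrough x (w + s • c) (hxs s))⟩, S.cam⟩
  refine Set.infinite_of_injective_forall_mem (f := f) ?_ ?_
  · intro s s' hss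
    have h1 : Submodule.span ℂ {x, w + s • c} = Submodule.span ℂ {x, w + s' • c} := by
      have := congrArg (fun A => (A.arr.line j).1) hss
      simpa [f, lineThrough] using this
    have h2 : w + s • c ∈ Submodule.span ℂ {x, w + s' • c} := by
      rw [← h1]; exact Submodule.subset_span (by simp)
    obtain ⟨a, b, hab⟩ := Submodule.mem_span_pair.1 h2
    have h3 : s = b * s' := by
      by_contra hne
      have hne' : s - b * s' ≠ 0 := sub_ne_zero.2 hne
      refine hc (Submodule.mem_span_pair.2
        ⟨(s - b * s')⁻¹ * a, (s - b * s')⁻¹ * (b - 1), ?_⟩)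
      have : a • x + (b - 1) • w = (s - b * s') • c := by
        rw [smul_add, smul_smul] at hab
        rw [sub_smul, sub_smul, one_smul]
        have h5 := congrArg (fun u => u - w - (b * s') • c) hab
        have e1 : a • x + (b • w + (b * s') • c) - w - (b * s') • c = a • x + (b • w - w) := by abel
        have e2 : w + s • c - w - (b * s') • c = s • c - (b * s') • c := by abel
        rw [e1, e2] at h5
        exact h5
      rw [mul_smul, mul_smul, ← smul_add, this, smul_smul, inv_mul_cancel₀ hne', one_smul]
    rw [LinearIndependent.pair_iff] at hxw
    have h4 := hxw a (b - 1) (by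
      rw [h3, smul_add, smul_smul, ← add_assoc] at hab
      have := add_right_cancel hab
      rw [sub_smul, one_smul, ← add_sub_assoc, this, sub_self])
    rw [h3, sub_eq_zero.1 h4.2, one_mul]
  · intro s
    have hmap : ∀ v, j ∈ D.obsLn v → (S.cam v) *ᵥ (w + s • c) = S.cam v *ᵥ w := by
      intro v hv
      obtain rfl := hj v hv
      rw [Matrix.mulVec_add, Matrix.mulVec_smul, hcv hv, smul_zero, add_zero]
    refine ⟨⟨?_, hS.2⟩, hSp, ?_⟩
    · intro i k hik
      by_cases hk : k = j
      · subst hk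
        show (S.arr.point i).submodule ≤ _
        have : x = F.pt i := hFi i k hik
        simp only [f, Function.update_self]
        rw [← hF]
        show Projectivization.submodule (Projectivization.mk ℂ _ _) ≤ Submodule.span ℂ _
        rw [Projectivization.submodule_mk, ← this]
        exact Submodule.span_mono (by simp)
      · show OnLine (S.arr.point i) (Function.update S.arr.line j _ k)
        rw [Function.update_of_ne hk]
        exact hS.1 i k hik
    · intro b
      show Submodule.map _ (Function.update S.arr.line j _ b.1.2).1 = _
      by_cases hk : b.1.2 = j
      · have hv := b.2
        rw [hk] at hv
        rw [hk, Function.update_self, ← hSl b, hk, hW]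
        simp only [lineThrough, Submodule.map_span, Set.image_insert_eq, Set.image_singleton,
          Matrix.mulVecLin_apply]
        rw [hmap _ hv]
      · rw [Function.update_of_ne hk]
        exact hSl b

/-- A point on no line which is seen in at most one view can be moved along its viewing ray. -/
lemma infinite_solutions_of_point {y : D.Image} (hy : (D.solutions y).Nonempty)
    (i : P) (hi : ∀ j, ¬ D.inc i j) (v₀ : Fin m) (hv : ∀ v, i ∈ D.obsPt v → v = v₀) :
    (D.solutions y).Infinite := by
  classical
  obtain ⟨S, hS, hSp, hSl⟩ := hy
  set x := (S.arr.point i).rep with hx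
  have hx0 : x ≠ 0 := (S.arr.point i).rep_nonzero
  have hX : (S.arr.point i).submodule = Submodule.span ℂ {x} := Projectivization.submodule_eq _
  obtain ⟨c, hc, hcv⟩ : ∃ c : Fin 4 → ℂ, c ∉ Submodule.span ℂ {x} ∧
      (i ∈ D.obsPt v₀ → S.cam v₀ *ᵥ c = 0) := by
    by_cases h : i ∈ D.obsPt v₀
    · obtain ⟨c, hc0, hc⟩ := (S.cam v₀).exists_ker
      refine ⟨c, fun hcW => hc0 ?_, fun _ => hc⟩
      refine eq_zero_of_map_finrank_eq (S.cam v₀).mulVecLin ?_ hcW hc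
      rw [← hX, hSp ⟨(v₀, i), h⟩, Projectivization.finrank_submodule,
        Projectivization.finrank_submodule]
    · have : Submodule.span ℂ {x} ≠ ⊤ := fun h' => by
        have := finrank_span_singleton (K := ℂ) hx0
        rw [h'] at this
        simp at this
      obtain ⟨c, -, hc⟩ := SetLike.exists_of_lt this.lt_top
      exact ⟨c, hc, fun h' => absurd h' h⟩
  have hxs : ∀ s : ℂ, x + s • c ≠ 0 := by
    intro s h0
    by_cases hs : s = 0
    · rw [hs, zero_smul, add_zero] at h0; exact hx0 h0
    · refine hc (Submodule.mem_span_singleton.2 ⟨-s⁻¹, ?_⟩)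
      rw [eq_neg_of_add_eq_zero_left h0, smul_neg, neg_smul, neg_neg, smul_smul,
        inv_mul_cancel₀ hs, one_smul]
  let f : ℂ → Configuration P L m := fun s =>
    ⟨⟨Function.update S.arr.point i (Projectivization.mk ℂ (x + s • c) (hxs s)), S.arr.line⟩,
      S.cam⟩
  refine Set.infinite_of_injective_forall_mem (f := f) ?_ ?_
  · intro s s' hss
    have h1 : Projectivization.mk ℂ (x + s • c) (hxs s)
        = Projectivization.mk ℂ (x + s' • c) (hxs s') := by
      have := congrArg (fun A => (A.arr.point i)) hss
      simpa [f] using this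
    rw [Projectivization.mk_eq_mk_iff'] at h1
    obtain ⟨b, hb⟩ := h1
    have h3 : s = b * s' := by
      by_contra hne
      have hne' : s - b * s' ≠ 0 := sub_ne_zero.2 hne
      refine hc (Submodule.mem_span_singleton.2 ⟨(s - b * s')⁻¹ * (b - 1), ?_⟩)
      have : (b - 1) • x = (s - b * s') • c := by
        rw [smul_add, smul_smul] at hb
        rw [sub_smul, sub_smul, one_smul, sub_eq_sub_iff_add_eq_add, hb, add_comm]
      rw [mul_smul, this, smul_smul, inv_mul_cancel₀ hne', one_smul]
    have h4 : (b - 1) • x = 0 := by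
      rw [h3, smul_add, smul_smul] at hb
      rw [sub_smul, one_smul, add_right_cancel hb, sub_self]
    rw [h3, sub_eq_zero.1 ((smul_eq_zero.1 h4).resolve_right hx0), one_mul]
  · intro s
    refine ⟨⟨?_, hS.2⟩, ?_, hSl⟩
    · intro i' k hik
      have hne : i' ≠ i := fun h => hi k (h ▸ hik)
      show OnLine (Function.update S.arr.point i _ i') (S.arr.line k)
      rw [Function.update_of_ne hne]
      exact hS.1 i' k hik
    · intro a
      show Submodule.map _ (Projectivization.submodule (Function.update S.arr.point i _ a.1.2)) = _
      by_cases hk : a.1.2 = i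
      · have hv' := a.2
        rw [hk] at hv'
        rw [hk, Function.update_self, ← hSp a, hk, hX, Projectivization.submodule_mk]
        have : (f s).cam a.1.1 *ᵥ c = 0 := by
          have e := hv _ hv'
          rw [e] at hv' ⊢
          exact hcv hv'
        simp only [Submodule.map_span, Set.image_singleton, Matrix.mulVecLin_apply,
          Matrix.mulVec_add, Matrix.mulVec_smul, this, smul_zero, add_zero]
        rfl
      · rw [Function.update_of_ne hk]
        exact hSp a

end PointLineProblem

/-! ### Forgetting a point -/

lemma Generic.of_forall {A : Type*} [TopologicalSpace A] {V : Set A} {Q : A → Prop}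
    (h : ∀ a ∈ V, Q a) : Generic V Q :=
  ⟨Set.univ, isOpen_univ, by simpa using subset_closure, fun a ha => h a ha.2⟩

namespace PointLineProblem

variable {P L : Type*} {m : ℕ} (D : PointLineProblem P L m)

/-- A point with a single pin can be forgotten if it is seen in at most one view, together with
its pin: it lies on the known line, at the preimage of its image. -/
lemma reducibleTo_of_point {i : P} {j : L} (hij : D.pins i = {j})
    (hv : ∀ v v', i ∈ D.obsPt v → i ∈ D.obsPt v' → v = v')
    (hl : ∀ v, i ∈ D.obsPt v → j ∈ D.obsLn v) : D.ReducibleTo {i}ᶜ Set.univ := by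
  classical
  have hinc : ∀ k, D.inc i k ↔ k = j := fun k => by
    rw [← Set.mem_singleton_iff, ← hij]; rfl
  refine ⟨fun i' hi' k _ k' _ hk hk' => ?_, Generic.of_forall fun S' hS' =>
    Generic.of_forall fun y hy => ?_⟩
  · rw [Set.notMem_compl_iff, Set.mem_singleton_iff] at hi'
    subst hi'
    exact ((hinc k).1 hk).trans ((hinc k').1 hk').symm
  obtain ⟨hyV, hyp, hyl⟩ := hy
  obtain ⟨x, hxl, hx⟩ : ∃ x : ProjPoint 4, OnLine x (S'.arr.line ⟨j, trivial⟩) ∧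
      ∀ v (h : i ∈ D.obsPt v),
        x.submodule.map (S'.cam v).mulVecLin = (y.point ⟨(v, i), h⟩).submodule := by
    by_cases h : ∃ v, i ∈ D.obsPt v
    · obtain ⟨v, h⟩ := h
      have h1 := hyl ⟨(v, ⟨j, trivial⟩), hl v h⟩
      have h2 := hyV ⟨(v, i), h⟩ ⟨(v, j), hl v h⟩ ⟨rfl, (hinc j).2 rfl⟩
      have h3 : (y.point ⟨(v, i), h⟩).rep ∈
          (S'.arr.line ⟨j, trivial⟩).1.map (S'.cam v).mulVecLin := by
        rw [h1]; exact onLine_iff.1 h2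
      obtain ⟨X, hX, hXy⟩ := h3
      have hX0 : X ≠ 0 := fun h0 => by
        rw [h0, map_zero] at hXy
        exact Projectivization.rep_nonzero _ hXy.symm
      refine ⟨Projectivization.mk ℂ X hX0, ?_, fun v' h' => ?_⟩
      · rw [OnLine, Projectivization.submodule_mk, Submodule.span_singleton_le_iff_mem]
        exact hX
      · obtain rfl := hv v v' h h'
        rw [Projectivization.submodule_mk, Submodule.map_span, Set.image_singleton, hXy,
          Projectivization.submodule_eq]
    · obtain ⟨X, hX, hX0⟩ := exists_ne_zero_mem (S'.arr.line ⟨j, trivial⟩).2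
      refine ⟨Projectivization.mk ℂ X hX0, ?_, fun v' h' => absurd ⟨v', h'⟩ h⟩
      rw [OnLine, Projectivization.submodule_mk, Submodule.span_singleton_le_iff_mem]
      exact hX
  let A : Arrangement 4 P L :=
    { point := fun i' => if h : i' = i then x else S'.arr.point ⟨i', h⟩
      line := fun k => S'.arr.line ⟨k, trivial⟩ }
  have hAi : A.point i = x := dif_pos rfl
  have hAne : ∀ i' (h : i' ≠ i), A.point i' = S'.arr.point ⟨i', h⟩ := fun i' h => dif_neg h
  refine ⟨A, ?_, ⟨?_, ?_⟩, ?_⟩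
  · intro i' k hik
    by_cases h : i' = i
    · subst h
      obtain rfl := (hinc k).1 hik
      rw [hAi]; exact hxl
    · rw [hAne i' h]
      exact hS'.1 ⟨i', h⟩ ⟨k, trivial⟩ hik
  · rintro ⟨⟨v, i'⟩, h'⟩
    dsimp only at h' ⊢
    by_cases h : i' = i
    · subst h
      rw [hAi]; exact hx v h'
    · rw [hAne i' h]
      exact hyp ⟨(v, ⟨i', h⟩), h'⟩
  · rintro ⟨⟨v, k⟩, h'⟩
    exact hyl ⟨(v, ⟨k, trivial⟩), h'⟩
  · ext1
    · funext i'
      exact hAne i'.1 i'.2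
    · rfl

end PointLineProblem

/-! ### Polynomial functions of coordinates -/

/-- Functions on affine space which are given by a polynomial. -/
def IsPoly {ι : Type*} (φ : (ι → ℂ) → ℂ) : Prop :=
  ∃ f : MvPolynomial ι ℂ, ∀ z, MvPolynomial.eval z f = φ z

namespace IsPoly

variable {ι : Type*} {φ ψ : (ι → ℂ) → ℂ}

lemma const (a : ℂ) : IsPoly fun _ : ι → ℂ => a := ⟨MvPolynomial.C a, fun z => by simp⟩

lemma coord (i : ι) : IsPoly fun z : ι → ℂ => z i := ⟨MvPolynomial.X i, fun z => by simp⟩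

lemma add (h : IsPoly φ) (h' : IsPoly ψ) : IsPoly fun z => φ z + ψ z := by
  obtain ⟨f, hf⟩ := h
  obtain ⟨g, hg⟩ := h'
  exact ⟨f + g, fun z => by rw [map_add, hf, hg]⟩

lemma mul (h : IsPoly φ) (h' : IsPoly ψ) : IsPoly fun z => φ z * ψ z := by
  obtain ⟨f, hf⟩ := h
  obtain ⟨g, hg⟩ := h'
  exact ⟨f * g, fun z => by rw [map_mul, hf, hg]⟩

lemma neg (h : IsPoly φ) : IsPoly fun z => -φ z := by
  obtain ⟨f, hf⟩ := h
  exact ⟨-f, fun z => by rw [map_neg, hf]⟩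

lemma sub (h : IsPoly φ) (h' : IsPoly ψ) : IsPoly fun z => φ z - ψ z := by
  simpa only [sub_eq_add_neg] using h.add h'.neg

lemma sum {κ : Type*} (s : Finset κ) {φ : κ → (ι → ℂ) → ℂ} (h : ∀ k, IsPoly (φ k)) :
    IsPoly fun z => ∑ k ∈ s, φ k z := by
  choose f hf using h
  exact ⟨∑ k ∈ s, f k, fun z => by rw [map_sum]; exact Finset.sum_congr rfl fun k _ => hf k z⟩

lemma prod {κ : Type*} (s : Finset κ) {φ : κ → (ι → ℂ) → ℂ} (h : ∀ k, IsPoly (φ k)) :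
    IsPoly fun z => ∏ k ∈ s, φ k z := by
  choose f hf using h
  exact ⟨∏ k ∈ s, f k, fun z => by rw [map_prod]; exact Finset.prod_congr rfl fun k _ => hf k z⟩

lemma mulVec {a b : ℕ} {M : (ι → ℂ) → Matrix (Fin a) (Fin b) ℂ} {u : (ι → ℂ) → Fin b → ℂ}
    (hM : ∀ k l, IsPoly fun z => M z k l) (hu : ∀ l, IsPoly fun z => u z l) (k : Fin a) :
    IsPoly fun z => (M z *ᵥ u z) k :=
  sum Finset.univ fun l => (hM k l).mul (hu l)

lemma dotProduct {a : ℕ} {u w : (ι → ℂ) → Fin a → ℂ}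
    (hu : ∀ l, IsPoly fun z => u z l) (hw : ∀ l, IsPoly fun z => w z l) :
    IsPoly fun z => u z ⬝ᵥ w z :=
  sum _ fun l => (hu l).mul (hw l)

lemma cross {u w : (ι → ℂ) → Fin 3 → ℂ}
    (hu : ∀ l, IsPoly fun z => u z l) (hw : ∀ l, IsPoly fun z => w z l) (k : Fin 3) :
    IsPoly fun z => crossProduct (u z) (w z) k := by
  simp only [cross_apply]
  fin_cases k
  · exact ((hu 1).mul (hw 2)).sub ((hu 2).mul (hw 1))
  · exact ((hu 2).mul (hw 0)).sub ((hu 0).mul (hw 2))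
  · exact ((hu 0).mul (hw 1)).sub ((hu 1).mul (hw 0))

lemma det {n : ℕ} {M : (ι → ℂ) → Matrix (Fin n) (Fin n) ℂ}
    (hM : ∀ k l, IsPoly fun z => M z k l) : IsPoly fun z => (M z).det := by
  simp only [Matrix.det_apply']
  exact sum _ fun σ => (const _).mul (prod _ fun k => hM _ _)

lemma finite_zeros (h : IsPoly φ) {z d : ι → ℂ} (s₁ : ℂ) (h1 : φ (z + s₁ • d) ≠ 0) :
    {s : ℂ | φ (z + s • d) = 0}.Finite := by
  obtain ⟨f, hf⟩ := h
  simp only [← hf] at h1 ⊢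
  exact finite_zeros_on_line f z d s₁ h1

/-- The set where some polynomial function from a family does not vanish is open. -/
lemma isOpen {X Y κ : Type*} {q : X → Y} {c : X → ι → ℂ} [t : TopologicalSpace Y]
    (ht : t = TopologicalSpace.coinduced q (TopologicalSpace.induced c (affineZariski ι)))
    {φ : κ → (ι → ℂ) → ℂ} (h : ∀ k, IsPoly (φ k)) {W : Set Y}
    (hW : ∀ x, q x ∈ W ↔ ∃ k, φ k (c x) ≠ 0) : IsOpen W := by
  rw [ht, isOpen_coinduced_zariski_iff]
  intro x hx
  obtain ⟨k, hk⟩ := (hW x).1 hx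
  obtain ⟨f, hf⟩ := h k
  exact ⟨f, by rwa [hf], fun x' hx' => (hW x').2 ⟨k, by rwa [← hf]⟩⟩

end IsPoly

/-! ### Vectors in `ℂ³` -/

lemma exists_dotProduct_cross_ne_zero {x e : Fin 3 → ℂ} (h : crossProduct x e ≠ 0) :
    ∃ n : Fin 3 → ℂ, e ⬝ᵥ crossProduct x n ≠ 0 := by
  obtain ⟨k, hk⟩ := Function.ne_iff.1 h
  refine ⟨Pi.single k 1, ?_⟩
  rw [triple_product_permutation, triple_product_permutation, ← cross_anticomm,
    single_one_dotProduct]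
  simpa using hk

lemma exists_cross_ne_zero {e : Fin 3 → ℂ} (h : e ≠ 0) : ∃ x : Fin 3 → ℂ, crossProduct x e ≠ 0 := by
  by_contra! hcon
  apply h
  have h0 := hcon (Pi.single 0 1)
  have h1 := hcon (Pi.single 1 1)
  have a := congrFun h0 1
  have b := congrFun h0 2
  have c := congrFun h1 2
  simp [cross_apply] at a b c
  ext k; fin_cases k
  exacts [c, b, a]

lemma notMem_span_pair_iff {u x w : Fin 3 → ℂ} (h : LinearIndependent ℂ ![x, w]) :
    u ∉ Submodule.span ℂ {x, w} ↔ u ⬝ᵥ crossProduct x w ≠ 0 := by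
  rw [triple_product_eq_det]
  have h1 := linearIndependent_finCons (K := ℂ) (v := ![x, w]) (x := u)
  rw [span_pair_eq] at h1
  have h2 := Matrix.linearIndependent_rows_iff_isUnit (A := Matrix.of ![u, x, w])
  rw [Matrix.isUnit_iff_isUnit_det, isUnit_iff_ne_zero] at h2
  refine Iff.trans ?_ h2
  exact ⟨fun h' => h1.2 ⟨h, h'⟩, fun h' => (h1.1 h').2⟩

lemma linearIndependent_of_dotProduct_cross {u x w : Fin 3 → ℂ}
    (h : u ⬝ᵥ crossProduct x w ≠ 0) : LinearIndependent ℂ ![x, w] := by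
  rw [← crossProduct_ne_zero_iff_linearIndependent]
  intro h0
  rw [h0, dotProduct_zero] at h
  exact h rfl

/-- Lines in two images determine a line in space, unless one of them contains the epipole. -/
lemma exists_line_of_images {C C' : Camera} (hC : C.rot * C.rot.transpose = 1)
    (hC' : C'.rot * C'.rot.transpose = 1) (ℓ ℓ' : ProjLine 3)
    (h : C *ᵥ C'.center ∉ ℓ.1) (h' : C' *ᵥ C.center ∉ ℓ'.1) :
    ∃ W : ProjLine 4, W.1.map C.mulVecLin = ℓ.1 ∧ W.1.map C'.mulVecLin = ℓ'.1 ∧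
      ∀ X, C *ᵥ X ∈ ℓ.1 → C' *ᵥ X ∈ ℓ'.1 → X ∈ W.1 := by
  have key : ∀ (ℓ : ProjLine 3) (e : Fin 3 → ℂ), e ∉ ℓ.1 →
      ∃ φ : (Fin 3 → ℂ) →ₗ[ℂ] ℂ, φ e ≠ 0 ∧ ℓ.1 = LinearMap.ker φ := by
    intro ℓ e he
    obtain ⟨φ, hφ, hle⟩ := Submodule.exists_le_ker_of_notMem he
    refine ⟨φ, hφ, Submodule.eq_of_le_of_finrank_eq hle ?_⟩
    have h1 := LinearMap.finrank_range_add_finrank_ker φ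
    have h2 : LinearMap.range φ = ⊤ := LinearMap.range_eq_top.2
      (LinearMap.surjective (fun h0 => hφ (by rw [h0]; rfl)))
    rw [h2] at h1
    simp at h1
    rw [ℓ.2]; omega
  obtain ⟨φ, hφ, hℓ⟩ := key ℓ _ h
  obtain ⟨φ', hφ', hℓ'⟩ := key ℓ' _ h'
  let f : (Fin 4 → ℂ) →ₗ[ℂ] ℂ × ℂ := (φ ∘ₗ C.mulVecLin).prod (φ' ∘ₗ C'.mulVecLin)
  have hf : ∀ X, X ∈ LinearMap.ker f ↔ φ (C *ᵥ X) = 0 ∧ φ' (C' *ᵥ X) = 0 := by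
    intro X
    simp [f]
  have hrange : LinearMap.range f = ⊤ := by
    rw [LinearMap.range_eq_top]
    rintro ⟨a, b⟩
    refine ⟨(a / φ (C *ᵥ C'.center)) • C'.center + (b / φ' (C' *ᵥ C.center)) • C.center, ?_⟩
    simp [f, Camera.mulVec_center hC, Camera.mulVec_center hC', Matrix.mulVec_add,
      Matrix.mulVec_smul, hφ, hφ']
  have hker : finrank ℂ (LinearMap.ker f) = 2 := by
    have h1 := LinearMap.finrank_range_add_finrank_ker f
    rw [hrange] at h1
    simp at h1
    omega
  refine ⟨⟨LinearMap.ker f, hker⟩, ?_, ?_, fun X hX hX' => ?_⟩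
  · apply le_antisymm
    · rintro _ ⟨X, hX, rfl⟩
      rw [hℓ]; exact ((hf X).1 hX).1
    · intro u hu
      obtain ⟨X, rfl⟩ := Camera.exists_mulVec_eq hC u
      refine ⟨X - (φ' (C' *ᵥ X) / φ' (C' *ᵥ C.center)) • C.center, (hf _).2 ?_, ?_⟩
      · rw [hℓ] at hu
        simp [Matrix.mulVec_sub, Matrix.mulVec_smul, Camera.mulVec_center hC, hφ']
        exact hu
      · simp [Matrix.mulVec_sub, Matrix.mulVec_smul, Camera.mulVec_center hC]
  · apply le_antisymm
    · rintro _ ⟨X, hX, rfl⟩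
      rw [hℓ']; exact ((hf X).1 hX).2
    · intro u hu
      obtain ⟨X, rfl⟩ := Camera.exists_mulVec_eq hC' u
      refine ⟨X - (φ (C *ᵥ X) / φ (C *ᵥ C'.center)) • C'.center, (hf _).2 ?_, ?_⟩
      · rw [hℓ'] at hu
        simp [Matrix.mulVec_sub, Matrix.mulVec_smul, Camera.mulVec_center hC', hφ]
        exact hu
      · simp [Matrix.mulVec_sub, Matrix.mulVec_smul, Camera.mulVec_center hC']
  · rw [hℓ] at hX
    rw [hℓ'] at hX'
    exact (hf X).2 ⟨hX, hX'⟩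

/-- If the image of `X` differs from the epipole in one view, then also in the other. -/
lemma cross_epipole_ne_zero {C C' : Camera} (hC : C.rot * C.rot.transpose = 1)
    (hC' : C'.rot * C'.rot.transpose = 1) {X : Fin 4 → ℂ}
    (h : crossProduct (C *ᵥ X) (C *ᵥ C'.center) ≠ 0) :
    crossProduct (C' *ᵥ X) (C' *ᵥ C.center) ≠ 0 := by
  rw [crossProduct_ne_zero_iff_linearIndependent, LinearIndependent.pair_iff] at h ⊢
  intro a b hab
  rw [← Matrix.mulVec_smul, ← Matrix.mulVec_smul, ← Matrix.mulVec_add] at hab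
  have h1 := Camera.eq_smul_center hC' hab
  set r := (a • X + b • C.center) (Fin.last 3)
  have h2 := congrArg (fun v => C *ᵥ v) h1
  simp only [Matrix.mulVec_add, Matrix.mulVec_smul, Camera.mulVec_center hC, smul_zero,
    add_zero] at h2
  have h3 := h a (-r) (by rw [h2, neg_smul, add_neg_cancel])
  refine ⟨h3.1, ?_⟩
  rw [h3.1, neg_eq_zero.1 h3.2, zero_smul, zero_smul, zero_add] at h1
  exact (smul_eq_zero.1 h1).resolve_right C.center_ne_zero

lemma epipole_ne_zero {C C' : Camera} (hC : C.rot * C.rot.transpose = 1)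
    (h : C.center ≠ C'.center) : C *ᵥ C'.center ≠ 0 := fun h0 => by
  have := Camera.eq_smul_center hC h0
  rw [C'.center_last, one_smul] at this
  exact h this.symm

/-! ### Image lines avoiding given points -/

lemma isOpen_notMem_line {P L : Type*} (u : Fin 3 → ℂ) (j : L) :
    IsOpen {y : Arrangement 3 P L | u ∉ (y.line j).1} := by
  refine IsPoly.isOpen (κ := Unit) rfl
    (φ := fun _ z => u ⬝ᵥ crossProduct (fun a => z (Sum.inr (j, 0, a)))
      (fun a => z (Sum.inr (j, 1, a)))) (fun _ => ?_) (fun F => ?_)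
  · exact IsPoly.dotProduct (fun l => IsPoly.const _)
      (IsPoly.cross (fun l => IsPoly.coord _) (fun l => IsPoly.coord _))
  · have h : LinearIndependent ℂ ![F.ln j 0, F.ln j 1] := by
      convert F.ln_indep j using 1
      ext a; fin_cases a <;> rfl
    have := notMem_span_pair_iff (u := u) h
    rw [← span_pair_eq] at this
    exact this.trans ⟨fun h => ⟨(), h⟩, fun ⟨_, h⟩ => h⟩

/-- Generically, the lines `j ∈ J` avoid given points `e j` of the plane, even with all points and
all other lines fixed: a line through a point different from `e j` can be rotated about it. -/
lemma mem_closure_notMem_line {P L : Type*} [Finite L] {inc : P → L → Prop}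
    (hinc : ∀ i i' j, inc i j → inc i' j → i = i') {y : Arrangement 3 P L}
    (hy : y ∈ incidenceVariety 3 inc) (J : Set L) (e : L → Fin 3 → ℂ)
    (he : ∀ j ∈ J, e j ≠ 0)
    (hx : ∀ j ∈ J, ∀ i, inc i j → crossProduct (y.point i).rep (e j) ≠ 0) :
    y ∈ closure {y' | (∀ j ∈ J, e j ∉ (y'.line j).1) ∧ y' ∈ incidenceVariety 3 inc ∧
      y'.point = y.point ∧ ∀ j, j ∉ J → y'.line j = y.line j} := by
  classical
  obtain ⟨F, rfl, hF⟩ := exists_adapted_frame hinc hy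
  have h1 : ∀ j, ∃ n : Fin 2 → Fin 3 → ℂ, (j ∈ J → e j ⬝ᵥ crossProduct (n 0) (n 1) ≠ 0) ∧
      (∀ i, inc i j → n 0 = F.pt i) := by
    intro j
    by_cases hJ : j ∈ J
    · by_cases hi : ∃ i, inc i j
      · obtain ⟨i, hi⟩ := hi
        have h2 : crossProduct (F.pt i) (e j) ≠ 0 := by
          intro h0
          apply hx j hJ i hi
          obtain ⟨a, ha⟩ := Projectivization.exists_smul_eq_mk_rep ℂ (F.pt i) (F.pt_ne i)
          show crossProduct (Projectivization.mk ℂ (F.pt i) (F.pt_ne i)).rep (e j) = 0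
          rw [← ha, Units.smul_def, map_smul, LinearMap.smul_apply, h0, smul_zero]
        obtain ⟨n, hn⟩ := exists_dotProduct_cross_ne_zero h2
        exact ⟨![F.pt i, n], fun _ => hn, fun i' hi' => by rw [hinc i' i j hi' hi]; rfl⟩
      · obtain ⟨x, hx'⟩ := exists_cross_ne_zero (he j hJ)
        obtain ⟨n, hn⟩ := exists_dotProduct_cross_ne_zero hx'
        exact ⟨![x, n], fun _ => hn, fun i' hi' => absurd ⟨i', hi'⟩ hi⟩
    · exact ⟨F.ln j, fun h => absurd h hJ, fun i hi => hF i j hi⟩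
  choose n hn hn' using h1
  let d : (P × Fin 3) ⊕ (L × Fin 2 × Fin 3) → ℂ := Sum.elim (fun _ => 0)
    (fun b => if b.1 ∈ J then n b.1 b.2.1 b.2.2 - F.ln b.1 b.2.1 b.2.2 else 0)
  let ln : ℂ → L → Fin 2 → Fin 3 → ℂ := fun s j k =>
    if j ∈ J then F.ln j k + s • (n j k - F.ln j k) else F.ln j k
  refine mem_closure_of_line (q := Frame.toArrangement) rfl F d ?_
  have hfin : ∀ j ∈ J, {s : ℂ | e j ⬝ᵥ crossProduct (ln s j 0) (ln s j 1) = 0}.Finite := by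
    intro j hj
    have hp : IsPoly fun z : (P × Fin 3) ⊕ (L × Fin 2 × Fin 3) → ℂ =>
        e j ⬝ᵥ crossProduct (fun a => z (Sum.inr (j, 0, a))) (fun a => z (Sum.inr (j, 1, a))) :=
      IsPoly.dotProduct (fun l => IsPoly.const _)
        (IsPoly.cross (fun l => IsPoly.coord _) (fun l => IsPoly.coord _))
    have hs : ∀ s k, (fun a => (F.coord + s • d) (Sum.inr (j, k, a))) = ln s j k := by
      intro s k
      ext a
      simp [ln, d, Frame.coord, hj]
    have := hp.finite_zeros (z := F.coord) (d := d) 1 (by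
      rw [hs, hs]
      simpa [ln, hj] using hn j hj)
    simpa only [hs] using this
  refine (J.toFinite.biUnion hfin).subset ?_
  intro s hs
  by_contra hbad
  simp only [Set.mem_iUnion, not_exists, Set.mem_ofPred_eq] at hbad
  apply hs
  have hind : ∀ j, LinearIndependent ℂ (ln s j) := by
    intro j
    by_cases hj : j ∈ J
    · convert linearIndependent_of_dotProduct_cross (hbad j hj) using 1
      ext a; fin_cases a <;> rfl
    · simp only [ln, if_neg hj]
      exact F.ln_indep j
  refine ⟨⟨F.pt, ln s, F.pt_ne, hind⟩, ?_, ?_, ?_, rfl, ?_⟩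
  · ext b
    rcases b with b | ⟨j, k, a⟩
    · simp [Frame.coord, d]
    · by_cases hj : j ∈ J <;> simp [Frame.coord, d, ln, hj]
  · intro j hj
    have := notMem_span_pair_iff (u := e j) (linearIndependent_of_dotProduct_cross (hbad j hj))
    rw [← span_pair_eq (ln s j)] at this
    exact this.2 (hbad j hj)
  · intro i j hij
    show Projectivization.submodule (Projectivization.mk ℂ _ _) ≤ Submodule.span ℂ _
    rw [Projectivization.submodule_mk, Submodule.span_singleton_le_iff_mem]
    have : F.pt i = ln s j 0 := by
      by_cases hj : j ∈ J
      · simp [ln, hj, hn' j i hij, hF i j hij]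
      · simp [ln, hj, hF i j hij]
    rw [this]
    exact Submodule.subset_span ⟨0, rfl⟩
  · intro j hj
    apply Subtype.ext
    show Submodule.span ℂ (Set.range (ln s j)) = Submodule.span ℂ (Set.range (F.ln j))
    simp only [ln, if_neg hj]

/-! ### Configurations in general position -/

/-- The coordinates of a frame together with cameras. -/
abbrev configCoord {P L : Type*} {m : ℕ} (F : Frame 4 P L × (Fin m → Camera)) :
    ((P × Fin 4) ⊕ (L × Fin 2 × Fin 4)) ⊕ (Fin m × Fin 3 × Fin 4) → ℂ :=
  Sum.elim F.1.coord (fun c : Fin m × Fin 3 × Fin 4 => F.2 c.1 c.2.1 c.2.2)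

/-- The configuration with given homogeneous coordinates. -/
abbrev configOf {P L : Type*} {m : ℕ} (F : Frame 4 P L × (Fin m → Camera)) :
    Configuration P L m := ⟨F.1.toArrangement, F.2⟩

/-- The cameras with given coordinates. -/
def coordCam {ι : Type*} {m : ℕ} (z : ι ⊕ (Fin m × Fin 3 × Fin 4) → ℂ) (v : Fin m) : Camera :=
  fun a b => z (Sum.inr (v, a, b))

lemma isPoly_coordCam {ι : Type*} {m : ℕ} (v : Fin m) (a : Fin 3) (b : Fin 4) :
    IsPoly fun z : ι ⊕ (Fin m × Fin 3 × Fin 4) → ℂ => coordCam z v a b := IsPoly.coord _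

lemma isPoly_epipole {ι : Type*} {m : ℕ} (v v' : Fin m) (k : Fin 3) :
    IsPoly fun z : ι ⊕ (Fin m × Fin 3 × Fin 4) → ℂ =>
      (coordCam z v *ᵥ (coordCam z v').center) k := by
  refine IsPoly.mulVec (fun a b => isPoly_coordCam v a b) (fun l => ?_) k
  refine Fin.lastCases ?_ (fun a => ?_) l
  · simp only [Camera.center_last]; exact IsPoly.const _
  · simp only [Camera.center_castSucc]
    exact (IsPoly.mulVec (M := fun z => (coordCam z v').rot.transpose)
      (u := fun z => (coordCam z v').trans) (fun a b => isPoly_coordCam v' _ _)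
      (fun a => isPoly_coordCam v' _ _) a).neg

/-- The images of the point `i` in view `v` and of the center of camera `v'` are distinct. -/
def AvoidsEpipole {P L : Type*} {m : ℕ} (i : P) (v v' : Fin m) (S : Configuration P L m) : Prop :=
  crossProduct (S.cam v *ᵥ (S.arr.point i).rep) (S.cam v *ᵥ (S.cam v').center) ≠ 0

lemma avoidsEpipole_configOf_iff {P L : Type*} {m : ℕ} (i : P) (v v' : Fin m)
    (F : Frame 4 P L × (Fin m → Camera)) : AvoidsEpipole i v v' (configOf F) ↔
      crossProduct (F.2 v *ᵥ F.1.pt i) (F.2 v *ᵥ (F.2 v').center) ≠ 0 := by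
  obtain ⟨a, ha⟩ := Projectivization.exists_smul_eq_mk_rep ℂ (F.1.pt i) (F.1.pt_ne i)
  rw [AvoidsEpipole]
  show crossProduct (F.2 v *ᵥ (Projectivization.mk ℂ (F.1.pt i) (F.1.pt_ne i)).rep) _ ≠ 0 ↔ _
  rw [← ha, Units.smul_def, Matrix.mulVec_smul, map_smul, LinearMap.smul_apply, Ne,
    smul_eq_zero, not_or]
  exact and_iff_right a.ne_zero

lemma isPoly_cross_epipole {P L : Type*} {m : ℕ} (i : P) (v v' : Fin m) (k : Fin 3) :
    IsPoly fun z : ((P × Fin 4) ⊕ (L × Fin 2 × Fin 4)) ⊕ (Fin m × Fin 3 × Fin 4) → ℂ =>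
      crossProduct (coordCam z v *ᵥ (fun a => z (Sum.inl (Sum.inl (i, a)))))
        (coordCam z v *ᵥ (coordCam z v').center) k :=
  IsPoly.cross (IsPoly.mulVec (fun a b => isPoly_coordCam v a b) fun _ => IsPoly.coord _)
    (isPoly_epipole v v') k

lemma isOpen_epipole_ne_zero {P L : Type*} {m : ℕ} (v v' : Fin m) :
    IsOpen {S : Configuration P L m | S.cam v *ᵥ (S.cam v').center ≠ 0} :=
  IsPoly.isOpen (q := configOf) (c := configCoord) rfl (isPoly_epipole v v') fun _ =>
    Function.ne_iff

lemma isOpen_avoidsEpipole {P L : Type*} {m : ℕ} (i : P) (v v' : Fin m) :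
    IsOpen {S : Configuration P L m | AvoidsEpipole i v v' S} :=
  IsPoly.isOpen (q := configOf) (c := configCoord) rfl (isPoly_cross_epipole i v v') fun F =>
    (avoidsEpipole_configOf_iff i v v' F).trans Function.ne_iff

/-- Move the third of three cameras by adding `τ` to its translation. -/
def moveThird (C : Fin 3 → Camera) (τ : Fin 3 → ℂ) : Fin 3 → Camera := fun v =>
  C v + if v = 2 then Matrix.of fun a b => if b = Fin.last 3 then τ a else 0
    else 0

lemma moveThird_rot (C : Fin 3 → Camera) (τ : Fin 3 → ℂ) (v : Fin 3) :
    (moveThird C τ v).rot = (C v).rot := by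
  ext a b
  simp only [moveThird, Camera.rot]
  split_ifs <;> simp [Matrix.add_apply, Fin.castSucc_ne_last b, -Fin.reduceLast]

lemma moveThird_trans_two (C : Fin 3 → Camera) (τ : Fin 3 → ℂ) :
    (moveThird C τ 2).trans = (C 2).trans + τ := by
  ext a
  simp [moveThird, Camera.trans]

lemma moveThird_of_ne (C : Fin 3 → Camera) (τ : Fin 3 → ℂ) {v : Fin 3} (h : v ≠ 2) :
    moveThird C τ v = C v := by
  simp [moveThird, h]

lemma moveThird_mem {C : Fin 3 → Camera} (hC : C ∈ cameraConfigs 3) (τ : Fin 3 → ℂ) :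
    moveThird C τ ∈ cameraConfigs 3 := by
  refine ⟨fun v => ?_, fun v hv => ?_, fun v hv => ?_⟩
  · rw [moveThird_rot]; exact hC.1 v
  · rw [moveThird_of_ne C τ (fun h => by simp [h] at hv)]; exact hC.2.1 v hv
  · rw [moveThird_of_ne C τ (fun h => by simp [h] at hv)]; exact hC.2.2 v hv

/-- The third camera can be moved such that two given cameras have distinct centers. -/
lemma exists_moveThird_center_ne {C : Fin 3 → Camera} (hC : C ∈ cameraConfigs 3) {v v' : Fin 3}
    (hv : v ≠ v') :
    ∃ τ, (moveThird C τ v).center ≠ (moveThird C τ v').center := by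
  have h2 : ∀ c : Fin 4 → ℂ, ∃ τ, (moveThird C τ 2).center ≠ c := by
    intro c
    by_contra! hcon
    have e0 := hcon 0
    have e1 := hcon ((C 2).rot *ᵥ Pi.single 0 1)
    have := congrFun (e0.trans e1.symm) (0 : Fin 3).castSucc
    rw [Camera.center_castSucc, Camera.center_castSucc, moveThird_rot, moveThird_rot,
      moveThird_trans_two, moveThird_trans_two, Matrix.mulVec_add, Matrix.mulVec_add,
      Matrix.mulVec_mulVec, mul_eq_one_comm.1 (hC.1 2).1] at this
    simp at this
  have h01 : (C 0).center ≠ (C 1).center := by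
    intro h
    have h0 := hC.2.1 0 rfl
    have h1 := hC.2.2 1 rfl
    have e : -((C 1).rot.transpose *ᵥ (C 1).trans) = 0 := by
      ext a
      have := congrFun h a.castSucc
      rw [Camera.center_castSucc, Camera.center_castSucc, h0.1, h0.2] at this
      simpa using this.symm
    have e' := congrArg (fun u => (C 1).rot *ᵥ u) (neg_eq_zero.1 e)
    simp only [Matrix.mulVec_mulVec, (hC.1 1).1, Matrix.one_mulVec, Matrix.mulVec_zero] at e'
    rw [e'] at h1
    simp at h1
  by_cases hv2 : v = 2
  · subst hv2
    obtain ⟨τ, hτ⟩ := h2 (C v').center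
    exact ⟨τ, by rwa [moveThird_of_ne C τ hv.symm]⟩
  by_cases hv2' : v' = 2
  · subst hv2'
    obtain ⟨τ, hτ⟩ := h2 (C v).center
    exact ⟨τ, by rw [moveThird_of_ne C τ hv]; exact hτ.symm⟩
  refine ⟨0, ?_⟩
  rw [moveThird_of_ne C 0 hv2, moveThird_of_ne C 0 hv2']
  fin_cases v <;> fin_cases v' <;> simp_all
  exact fun h => h01 h.symm

/-- Transform a frame by an invertible matrix. -/
def Frame.transform {n : ℕ} {P L : Type*} (F : Frame n P L) (g : Matrix (Fin n) (Fin n) ℂ)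
    (hg : IsUnit g) : Frame n P L where
  pt i := g *ᵥ F.pt i
  ln j k := g *ᵥ F.ln j k
  pt_ne i h := F.pt_ne i (Matrix.mulVec_injective_of_isUnit hg (by rw [h, Matrix.mulVec_zero]))
  ln_indep j := (F.ln_indep j).map' g.mulVecLin
    (LinearMap.ker_eq_bot.2 (Matrix.mulVec_injective_of_isUnit hg))

lemma Frame.transform_mem {n : ℕ} {P L : Type*} {inc : P → L → Prop} {F : Frame n P L}
    (hF : F.toArrangement ∈ incidenceVariety n inc) (g : Matrix (Fin n) (Fin n) ℂ)
    (hg : IsUnit g) : (F.transform g hg).toArrangement ∈ incidenceVariety n inc := by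
  intro i j hij
  have h : Projectivization.submodule (Projectivization.mk ℂ _ _) ≤
    Submodule.span ℂ (Set.range (F.ln j)) := hF i j hij
  show Projectivization.submodule (Projectivization.mk ℂ _ _) ≤
    Submodule.span ℂ (Set.range fun k => g *ᵥ F.ln j k)
  rw [Projectivization.submodule_mk, Submodule.span_singleton_le_iff_mem] at h ⊢
  have := Submodule.mem_map_of_mem (f := g.mulVecLin) h
  rw [Submodule.map_span, ← Set.range_comp] at this
  exact this

/-- In generic configurations, the centers of the cameras `v` and `v'` are distinct and the line
joining them does not contain the given point (the only element of `I`, if there is one): the third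
camera and, by a linear transformation, the whole arrangement can be moved. -/
lemma mem_closure_avoidsEpipole {P L : Type*} {inc : P → L → Prop}
    (hinc : ∀ i i' j, inc i j → inc i' j → i = i')
    {S : Configuration P L 3} (hS : S.arr ∈ incidenceVariety 4 inc) (hC : S.cam ∈ cameraConfigs 3)
    {v v' : Fin 3} (hv : v ≠ v') (I : Set P) (hI : I.Subsingleton) :
    S ∈ closure {S' | (S'.cam v *ᵥ (S'.cam v').center ≠ 0 ∧ ∀ i ∈ I, AvoidsEpipole i v v' S') ∧
      S'.arr ∈ incidenceVariety 4 inc ∧ S'.cam ∈ cameraConfigs 3} := by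
  classical
  obtain ⟨F, hF, -⟩ := exists_adapted_frame hinc hS
  obtain ⟨τ, hτ⟩ := exists_moveThird_center_ne hC hv
  have hSe : S = configOf (F, S.cam) := by
    ext1
    · exact hF.symm
    · rfl
  -- a target position of the point of `I`, off the baseline of the moved cameras
  obtain ⟨N, hN⟩ : ∃ N : Matrix (Fin 4) (Fin 4) ℂ, ∀ i ∈ I,
      crossProduct (moveThird S.cam τ v *ᵥ ((1 + N) *ᵥ F.pt i))
        (moveThird S.cam τ v *ᵥ (moveThird S.cam τ v').center) ≠ 0 := by
    rcases hI.eq_empty_or_singleton with rfl | ⟨i, rfl⟩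
    · exact ⟨0, by simp⟩
    have hrot := ((moveThird_mem hC τ).1 v).1
    obtain ⟨x, hx⟩ := exists_cross_ne_zero (epipole_ne_zero hrot hτ)
    obtain ⟨X, rfl⟩ := Camera.exists_mulVec_eq hrot x
    obtain ⟨k, hk⟩ := Function.ne_iff.1 (F.pt_ne i)
    refine ⟨Matrix.vecMulVec (X - F.pt i) (Pi.single k (F.pt i k)⁻¹), ?_⟩
    have hk' : F.pt i k ≠ 0 := hk
    have : (1 + Matrix.vecMulVec (X - F.pt i) (Pi.single k (F.pt i k)⁻¹)) *ᵥ F.pt i = X := by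
      rw [Matrix.add_mulVec, Matrix.one_mulVec, Matrix.vecMulVec_mulVec, single_dotProduct,
        inv_mul_cancel₀ hk']
      simp
    intro i' hi'
    rw [Set.mem_singleton_iff.1 hi', this]
    exact hx
  let d : ((P × Fin 4) ⊕ (L × Fin 2 × Fin 4)) ⊕ (Fin 3 × Fin 3 × Fin 4) → ℂ :=
    Sum.elim (Sum.elim (fun b => (N *ᵥ F.pt b.1) b.2) (fun b => (N *ᵥ F.ln b.1 b.2.1) b.2.2))
      (fun b => (moveThird S.cam τ - S.cam) b.1 b.2.1 b.2.2)
  have hcam : ∀ s : ℂ, coordCam (configCoord (F, S.cam) + s • d) = moveThird S.cam (s • τ) := by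
    intro s
    ext v a b
    by_cases hv : v = 2
    · subst hv
      by_cases hb : b = Fin.last 3 <;> simp [coordCam, moveThird, d, hb]
    · simp [coordCam, moveThird, d, hv]
  have hpt : ∀ (s : ℂ) i, (fun a => (configCoord (F, S.cam) + s • d) (Sum.inl (Sum.inl (i, a))))
      = (1 + s • N) *ᵥ F.pt i := by
    intro s i
    ext a
    simp [d, Frame.coord, Matrix.add_mulVec, Matrix.smul_mulVec]
  rw [hSe]
  refine mem_closure_of_line (q := configOf) (c := configCoord) rfl (F, S.cam) d ?_
  have f1 : {s : ℂ | (1 + s • N).det = 0}.Finite := by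
    have hp : IsPoly fun z : Fin 4 × Fin 4 → ℂ => (Matrix.of fun a b => z (a, b)).det :=
      IsPoly.det fun k l => IsPoly.coord (k, l)
    have := hp.finite_zeros (z := fun p => (1 : Matrix (Fin 4) (Fin 4) ℂ) p.1 p.2)
      (d := fun p => N p.1 p.2) 0 (by
        have : (Matrix.of fun a b => (1 : Matrix (Fin 4) (Fin 4) ℂ) a b) = 1 := rfl
        simp [this])
    exact this
  obtain ⟨k, hk⟩ := Function.ne_iff.1 (epipole_ne_zero ((moveThird_mem hC τ).1 v).1 hτ)
  have f2 := (isPoly_epipole v v' k).finite_zeros (z := configCoord (F, S.cam)) (d := d) 1 (by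
    rw [hcam, one_smul]; exact hk)
  have f3 : ∀ i ∈ I, {s : ℂ | crossProduct (moveThird S.cam (s • τ) v *ᵥ ((1 + s • N) *ᵥ F.pt i))
        (moveThird S.cam (s • τ) v *ᵥ (moveThird S.cam (s • τ) v').center) = 0}.Finite := by
    intro i hi
    obtain ⟨k, hk⟩ := Function.ne_iff.1 (hN i hi)
    have := (isPoly_cross_epipole i v v' k).finite_zeros (z := configCoord (F, S.cam)) (d := d) 1
      (by rw [hcam, hpt, one_smul, one_smul]; exact hk)
    refine this.subset fun s hs => ?_
    rw [Set.mem_ofPred_eq, hcam, hpt]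
    exact congrFun hs k
  refine ((f1.union f2).union (hI.finite.biUnion f3)).subset ?_
  intro s hs
  by_contra hbad
  simp only [Set.mem_union, Set.mem_iUnion, not_exists, Set.mem_ofPred_eq, not_or] at hbad
  apply hs
  have hg : IsUnit (1 + s • N) := by
    rw [Matrix.isUnit_iff_isUnit_det, isUnit_iff_ne_zero]; exact hbad.1.1
  have hF' : F.toArrangement ∈ incidenceVariety 4 inc := by rw [hF]; exact hS
  refine ⟨(F.transform _ hg, moveThird S.cam (s • τ)), ?_, ⟨?_, fun i hi => ?_⟩,
    Frame.transform_mem hF' _ hg, moveThird_mem hC _⟩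
  · ext b
    rcases b with (⟨i, a⟩ | ⟨j, k, a⟩) | ⟨v, a, b⟩
    · exact (congrFun (hpt s i) a).symm
    · simp [d, Frame.coord, Frame.transform, Matrix.add_mulVec, Matrix.smul_mulVec]
    · exact (congrFun (congrFun (congrFun (hcam s) v) a) b).symm
  · intro h0
    apply hbad.1.2
    rw [hcam]
    exact congrFun h0 k
  · rw [avoidsEpipole_configOf_iff]
    exact hbad.2 i hi

/-! ### Forgetting a line -/

namespace PointLineProblem

variable {P L : Type*} (D : PointLineProblem P L 3)

/-- A line that is seen in exactly two views can be forgotten if its points are seen in both of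
them: it is the intersection of two planes. -/
lemma reducibleTo_of_line [Finite L] (hD : D.IsPL1P) {j : L} {a b : Fin 3} (hab : a ≠ b)
    (hj : ∀ v, j ∈ D.obsLn v ↔ v = a ∨ v = b)
    (hp : ∀ i, D.inc i j → i ∈ D.obsPt a ∧ i ∈ D.obsPt b) : D.ReducibleTo Set.univ {j}ᶜ := by
  classical
  refine ⟨fun i hi => absurd trivial hi, ?_⟩
  let D' := D.restrict Set.univ {j}ᶜ
  have hD' : D'.IsPL1P := fun i i' k h h' => Subtype.ext (hD i.1 i'.1 k.1 h h')
  let I : Set (Set.univ : Set P) := {i | D.inc i.1 j}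
  have hI : I.Subsingleton := fun i hi i' hi' => Subtype.ext (hD i.1 i'.1 j hi hi')
  let U : Set (Configuration (Set.univ : Set P) ({j}ᶜ : Set L) 3) :=
    {S | S.cam a *ᵥ (S.cam b).center ≠ 0 ∧ ∀ i ∈ I, AvoidsEpipole i a b S}
  refine ⟨U, ?_, fun S hS => ?_, fun S hS => ?_⟩
  · have : U = {S | S.cam a *ᵥ (S.cam b).center ≠ 0} ∩ ⋂ i ∈ I, {S | AvoidsEpipole i a b S} := by
      ext S; simp [U]
    rw [this]
    exact (isOpen_epipole_ne_zero a b).inter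
      (hI.finite.isOpen_biInter fun i _ => isOpen_avoidsEpipole i a b)
  · exact mem_closure_avoidsEpipole hD' hS.1 hS.2 hab I hI
  obtain ⟨⟨hab0, hIa⟩, hSV, hSC⟩ := hS
  have ra := (hSC.1 a).1
  have rb := (hSC.1 b).1
  have hba0 : S.cam b *ᵥ (S.cam a).center ≠ 0 := by
    refine epipole_ne_zero rb fun h => hab0 ?_
    rw [h, Camera.mulVec_center ra]
  have hIb : ∀ i ∈ I, AvoidsEpipole i b a S := fun i hi => cross_epipole_ne_zero ra rb (hIa i hi)
  have hja : j ∈ D.obsLn a := (hj a).2 (Or.inl rfl)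
  have hjb : j ∈ D.obsLn b := (hj b).2 (Or.inr rfl)
  let J : Set D.ObsLn := {c | c.1.2 = j}
  let e : D.ObsLn → Fin 3 → ℂ := fun c =>
    if c.1.1 = a then S.cam a *ᵥ (S.cam b).center else S.cam b *ᵥ (S.cam a).center
  have hcJ : ∀ c ∈ J, c.1.1 = a ∨ c.1.1 = b := fun c hc => (hj _).1 (hc ▸ c.2)
  refine ⟨{y | ∀ c ∈ J, e c ∉ (y.line c).1}, ?_, fun y hy => ?_, fun y hy => ?_⟩
  · have : {y : D.Image | ∀ c ∈ J, e c ∉ (y.line c).1}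
        = ⋂ c ∈ J, {y | e c ∉ (y.line c).1} := by ext y; simp
    rw [this]
    exact J.toFinite.isOpen_biInter fun c _ => isOpen_notMem_line _ c
  · obtain ⟨hyV, hyp, hyl⟩ := hy
    refine closure_mono ?_ (mem_closure_notMem_line hD.imageInc hyV J e ?_ ?_)
    · rintro y' ⟨h1, h2, h3, h4⟩
      refine ⟨h1, h2, fun c => ?_, fun c => ?_⟩
      · rw [hyp c]
        show _ = (y'.point _).submodule
        rw [h3]; rfl
      · rw [hyl c]
        show _ = (y'.line _).1
        rw [h4 _ (fun h => c.1.2.2 h)]; rfl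
    · intro c hc
      by_cases h : c.1.1 = a
      · simpa [e, h] using hab0
      · simpa [e, h] using hba0
    · rintro c hc p ⟨hpc, hinc⟩
      rw [hc] at hinc
      have hpi : (⟨p.1.2, trivial⟩ : (Set.univ : Set P)) ∈ I := hinc
      -- the image point is a multiple of the projected point
      have h1 : (S.arr.point ⟨p.1.2, trivial⟩).submodule.map (S.cam p.1.1).mulVecLin
        = (y.point p).submodule := hyp ⟨(p.1.1, ⟨p.1.2, trivial⟩), p.2⟩
      have h2 : S.cam p.1.1 *ᵥ (S.arr.point ⟨p.1.2, trivial⟩).rep ∈ (y.point p).submodule := by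
        rw [← h1]
        exact Submodule.mem_map_of_mem (f := (S.cam p.1.1).mulVecLin) (rep_mem _)
      rw [Projectivization.submodule_eq] at h2
      obtain ⟨r, hr⟩ := Submodule.mem_span_singleton.1 h2
      intro h0
      by_cases h : c.1.1 = a
      · apply hIa _ hpi
        rw [hpc, h] at hr
        simp only [e, h, if_true] at h0
        rw [← hr, map_smul, LinearMap.smul_apply, h0, smul_zero]
      · have hb := (hcJ c hc).resolve_left h
        apply hIb _ hpi
        rw [hpc, hb] at hr
        simp only [e, h, if_false] at h0
        rw [← hr, map_smul, LinearMap.smul_apply, h0, smul_zero]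
  · obtain ⟨hyJ, hyV, hyp, hyl⟩ := hy
    have ha := hyJ ⟨(a, j), hja⟩ rfl
    have hb := hyJ ⟨(b, j), hjb⟩ rfl
    simp only [e, if_true] at ha
    simp only [e, hab.symm, if_false] at hb
    obtain ⟨W, hWa, hWb, hW⟩ := exists_line_of_images ra rb _ _ ha hb
    let A : Arrangement 4 P L :=
      { point := fun i => S.arr.point ⟨i, trivial⟩
        line := fun k => if h : k = j then W else S.arr.line ⟨k, h⟩ }
    have hAj : A.line j = W := dif_pos rfl
    have hAne : ∀ k (h : k ≠ j), A.line k = S.arr.line ⟨k, h⟩ := fun k h => dif_neg h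
    refine ⟨A, ?_, ⟨fun c => hyp ⟨(c.1.1, ⟨c.1.2, trivial⟩), c.2⟩, ?_⟩, ?_⟩
    · intro i k hik
      by_cases h : k = j
      · subst h
        rw [hAj, onLine_iff]
        have key : ∀ (v : Fin 3) (hv : i ∈ D.obsPt v) (hv' : k ∈ D.obsLn v),
            S.cam v *ᵥ (A.point i).rep ∈ (y.line ⟨(v, k), hv'⟩).1 := by
          intro v hv hv'
          have h1 : (A.point i).submodule.map (S.cam v).mulVecLin
            = (y.point ⟨(v, i), hv⟩).submodule := hyp ⟨(v, ⟨i, trivial⟩), hv⟩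
          have h2 : (y.point ⟨(v, i), hv⟩).submodule ≤ _ := hyV _ ⟨(v, k), hv'⟩ ⟨rfl, hik⟩
          apply h2
          rw [← h1]
          exact Submodule.mem_map_of_mem (f := (S.cam v).mulVecLin) (rep_mem _)
        exact hW _ (key a (hp i hik).1 hja) (key b (hp i hik).2 hjb)
      · rw [hAne k h]
        exact hSV ⟨i, trivial⟩ ⟨k, h⟩ hik
    · rintro ⟨⟨v, k⟩, hv⟩
      dsimp only at hv ⊢
      by_cases h : k = j
      · subst h
        rw [hAj]
        rcases (hj v).1 hv with rfl | rfl
        exacts [hWa, hWb]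
      · rw [hAne k h]
        exact hyl ⟨(v, ⟨k, h⟩), hv⟩
    · ext1
      · rfl
      · funext k
        exact hAne k.1 k.2

end PointLineProblem

/-! ### Images with algebraically independent coordinates -/

/-- Two vectors whose coordinates are algebraically independent are linearly independent. -/
lemma linearIndependent_of_algebraicIndependent {ι : Type*} {k : Subfield ℂ} {z : ι → ℂ}
    (hz : AlgebraicIndependent k z) {r : Fin 2 × Fin 3 → ι} (hr : Function.Injective r) :
    LinearIndependent ℂ (fun a c => z (r (a, c))) := by
  have hz' := hz.comp r hr
  have hne : z (r (0, 0)) * z (r (1, 1)) - z (r (0, 1)) * z (r (1, 0)) ≠ 0 := by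
    intro h0
    have h1 := hz'.eq_zero_of_aeval_eq_zero (MvPolynomial.X (0, 0) * MvPolynomial.X (1, 1)
      - MvPolynomial.X (0, 1) * MvPolynomial.X (1, 0)) (by simpa using h0)
    have h2 := congrArg (MvPolynomial.eval
      fun p : Fin 2 × Fin 3 => if p.1.val = p.2.val then 1 else 0) h1
    simp at h2
  have : LinearIndependent ℂ ![fun c => z (r (0, c)), fun c => z (r (1, c))] := by
    rw [LinearIndependent.pair_iff]
    intro s t hst
    have e0 := congrFun hst 0
    have e1 := congrFun hst 1
    simp only [Pi.add_apply, Pi.smul_apply, smul_eq_mul, Pi.zero_apply] at e0 e1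
    constructor
    · refine (mul_eq_zero.1 ?_).resolve_right hne
      linear_combination z (r (1, 1)) * e0 - z (r (1, 0)) * e1
    · refine (mul_eq_zero.1 ?_).resolve_right hne
      linear_combination z (r (0, 0)) * e1 - z (r (0, 1)) * e0
  convert this using 1
  ext a; fin_cases a <;> rfl

/-- A generic property of plane arrangements holds for an arrangement whose homogeneous
coordinates (a vector for each point, a second vector for each line through a prescribed point and
two vectors for each other line) are algebraically independent. -/
lemma Generic.exists_algebraicIndependent {P L : Type*} [Finite P] [Finite L] {inc : P → L → Prop}
    (hinc : ∀ i i' j, inc i j → inc i' j → i = i') {Q : Arrangement 3 P L → Prop}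
    (hne : (incidenceVariety 3 inc).Nonempty) (h : Generic (incidenceVariety 3 inc) Q) :
    ∃ (k : Subfield ℂ) (z : (P × Fin 3) ⊕ (L × Fin 2 × Fin 3) → ℂ) (F : Frame 3 P L),
      AlgebraicIndependent k z ∧ (∀ i c, F.pt i c = z (Sum.inl (i, c))) ∧
      (∀ j c, F.ln j 1 c = z (Sum.inr (j, 1, c))) ∧ (∀ i j, inc i j → F.ln j 0 = F.pt i) ∧
      Q F.toArrangement := by
  classical
  obtain ⟨U, hU, hd, hQ⟩ := h
  obtain ⟨A, hAV⟩ := hne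
  obtain ⟨A, hAU, hAV⟩ := closure_nonempty_iff.1 ⟨A, hd hAV⟩
  obtain ⟨F₀, rfl, hF₀⟩ := exists_adapted_frame hinc hAV
  obtain ⟨f, hf, hfU⟩ :=
    (isOpen_coinduced_zariski_iff Frame.toArrangement Frame.coord U).1 hU F₀ hAU
  -- `ρ` sends each coordinate of an adapted frame to the free parameter which it equals
  let ρ : (P × Fin 3) ⊕ (L × Fin 2 × Fin 3) → (P × Fin 3) ⊕ (L × Fin 2 × Fin 3) :=
    Sum.elim Sum.inl fun b =>
      if h : b.2.1 = 0 ∧ ∃ i, inc i b.1 then Sum.inl (h.2.choose, b.2.2) else Sum.inr b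
  have hρ : ∀ i j c, inc i j → ρ (Sum.inr (j, 0, c)) = Sum.inl (i, c) := by
    intro i j c hij
    have h : (0 : Fin 2) = 0 ∧ ∃ i, inc i j := ⟨rfl, i, hij⟩
    have : ρ (Sum.inr (j, 0, c)) = Sum.inl (h.2.choose, c) := dif_pos h
    rw [this, hinc _ _ _ h.2.choose_spec hij]
  have hρ' : ∀ j c, (∀ i, ¬ inc i j) → ρ (Sum.inr (j, 0, c)) = Sum.inr (j, 0, c) := by
    intro j c hj
    exact dif_neg fun h => hj _ h.2.choose_spec
  have hρ1 : ∀ j c, ρ (Sum.inr (j, 1, c)) = Sum.inr (j, 1, c) := fun j c => by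
    simp [ρ]
  have hfix : F₀.coord ∘ ρ = F₀.coord := by
    ext b
    rcases b with b | ⟨j, a, c⟩
    · rfl
    · fin_cases a
      · by_cases h : ∃ i, inc i j
        · obtain ⟨i, hi⟩ := h
          show F₀.coord (ρ (Sum.inr (j, 0, c))) = F₀.ln j 0 c
          rw [hρ i j c hi, hF₀ i j hi]; rfl
        · show F₀.coord (ρ (Sum.inr (j, 0, c))) = F₀.ln j 0 c
          rw [hρ' j c (fun i hi => h ⟨i, hi⟩)]; rfl
      · show F₀.coord (ρ (Sum.inr (j, 1, c))) = F₀.ln j 1 c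
        rw [hρ1]; rfl
  have hg : MvPolynomial.rename ρ f ≠ 0 := by
    intro h0
    apply hf
    rw [← hfix, ← MvPolynomial.eval_rename, h0, map_zero]
  obtain ⟨k, z, hz, hzf⟩ := exists_algebraicIndependent_eval_ne_zero hg
  rw [MvPolynomial.eval_rename] at hzf
  have hind : ∀ j, LinearIndependent ℂ
      fun (a : Fin 2) (c : Fin 3) => z (ρ (Sum.inr (j, a, c))) := by
    intro j
    refine linearIndependent_of_algebraicIndependent hz (r := fun p => ρ (Sum.inr (j, p.1, p.2))) ?_
    by_cases h : ∃ i, inc i j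
    · obtain ⟨i, hi⟩ := h
      rintro ⟨a, c⟩ ⟨a', c'⟩ hh
      fin_cases a <;> fin_cases a' <;> simp [hρ i j _ hi, hρ1] at hh ⊢ <;> exact hh
    · have h' : ∀ i, ¬ inc i j := fun i hi => h ⟨i, hi⟩
      rintro ⟨a, c⟩ ⟨a', c'⟩ hh
      fin_cases a <;> fin_cases a' <;> simp [hρ' j _ h', hρ1] at hh ⊢ <;> exact hh
  let F : Frame 3 P L := ⟨fun i c => z (Sum.inl (i, c)), fun j a c => z (ρ (Sum.inr (j, a, c))),
    fun i h => hz.ne_zero (Sum.inl (i, 0)) (congrFun h 0), hind⟩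
  have hF : F.coord = z ∘ ρ := by
    ext b
    rcases b with b | b <;> rfl
  have hFi : ∀ i j, inc i j → F.ln j 0 = F.pt i := fun i j hij =>
    funext fun c => congrArg z (hρ i j c hij)
  refine ⟨k, z, F, hz, fun i c => rfl, fun j c => congrArg z (hρ1 j c), hFi,
    hQ _ ⟨hfU F (by rw [hF]; exact hzf), fun i j hij => ?_⟩⟩
  show Projectivization.submodule (Projectivization.mk ℂ _ _) ≤ Submodule.span ℂ _
  rw [Projectivization.submodule_mk, Submodule.span_singleton_le_iff_mem, ← hFi i j hij]
  exact Submodule.subset_span ⟨0, rfl⟩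

/-! ### Dimension counts -/

/-- Three normalized calibrated cameras have transcendence degree at most eleven. -/
lemma exists_cameras_mem_algSpan (k : Subfield ℂ) {C : Fin 3 → Camera} (hC : C ∈ cameraConfigs 3) :
    ∃ g : Fin 11 → ℂ, ∀ v a b, C v a b ∈ algSpan k (Set.range g) := by
  obtain ⟨g₁, h₁⟩ := exists_orthogonal_mem_algSpan k (hC.1 1).1
  obtain ⟨g₂, h₂⟩ := exists_orthogonal_mem_algSpan k (hC.1 2).1
  let G : (Fin 3 ⊕ Fin 3) ⊕ (Fin 2 ⊕ Fin 3) → ℂ :=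
    Sum.elim (Sum.elim g₁ g₂) (Sum.elim (fun a => (C 1).trans a.succ) (C 2).trans)
  let ε : (Fin 3 ⊕ Fin 3) ⊕ (Fin 2 ⊕ Fin 3) ≃ Fin 11 := Fintype.equivFinOfCardEq (by simp)
  refine ⟨G ∘ ε.symm, ?_⟩
  rw [ε.symm.surjective.range_comp]
  have hG : ∀ c, G c ∈ algSpan k (Set.range G) := fun c => subset_algSpan k _ ⟨c, rfl⟩
  have hrot : ∀ v a b, (C v).rot a b ∈ algSpan k (Set.range G) := by
    intro v a b
    fin_cases v
    · show (C 0).rot a b ∈ _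
      rw [(hC.2.1 0 rfl).1, Matrix.one_apply]
      split_ifs
      exacts [one_mem _, zero_mem _]
    · refine algSpan_mono k ?_ (h₁ a b)
      rintro _ ⟨c, rfl⟩
      exact ⟨Sum.inl (Sum.inl c), rfl⟩
    · refine algSpan_mono k ?_ (h₂ a b)
      rintro _ ⟨c, rfl⟩
      exact ⟨Sum.inl (Sum.inr c), rfl⟩
  have htrans : ∀ v a, (C v).trans a ∈ algSpan k (Set.range G) := by
    intro v a
    fin_cases v
    · show (C 0).trans a ∈ _
      rw [(hC.2.1 0 rfl).2]
      exact zero_mem _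
    · refine Fin.cases ?_ (fun a => ?_) a
      · show (C 1).trans 0 ∈ _
        rw [hC.2.2 1 rfl]; exact one_mem _
      · exact hG (Sum.inr (Sum.inl a))
    · exact hG (Sum.inr (Sum.inr a))
  intro v a b
  refine Fin.lastCases ?_ (fun b => ?_) b
  exacts [htrans v a, hrot v a b]

lemma mulVec_mem {K : Subfield ℂ} {a b : ℕ} {M : Matrix (Fin a) (Fin b) ℂ} {u : Fin b → ℂ}
    (hM : ∀ i j, M i j ∈ K) (hu : ∀ j, u j ∈ K) (i : Fin a) : (M *ᵥ u) i ∈ K :=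
  sum_mem (t := Finset.univ) fun j _ => mul_mem (hM i j) (hu j)

/-- The dimension count for three views of points `Q` with pins `J`: the homogeneous coordinates
of the image points (`x`) and of second points on the image lines (`w`) are expressed by those in
the first view, one depth for each of `X` and `ω`, the scaling factors and the cameras.  The depths
`X q 3` of the points are supposed to be algebraic over the numbers `d`. -/
lemma card_le_of_views {k : Subfield ℂ} {Q J E : Type*} [Fintype Q] [Fintype J] [Fintype E]
    (π : J → Q) {C : Fin 3 → Camera} (hC : C ∈ cameraConfigs 3)
    {x : Fin 3 → Q → Fin 3 → ℂ} {w : Fin 3 → J → Fin 3 → ℂ}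
    {X : Q → Fin 4 → ℂ} {ω : J → Fin 4 → ℂ}
    (hX : ∀ q, C 0 *ᵥ X q = x 0 q) (hω : ∀ j, C 0 *ᵥ ω j = w 0 j)
    (hx : ∀ v q, ∃ μ : ℂ, x v q = μ • C v *ᵥ X q)
    (hw : ∀ v j, ∃ α β : ℂ, w v j = α • C v *ᵥ X (π j) + β • C v *ᵥ ω j)
    (d : E → ℂ) (hd : ∀ q, X q (Fin.last 3) ∈ algSpan k (Set.range d))
    (hind : AlgebraicIndependent k (Sum.elim (fun p : Fin 3 × Q × Fin 3 => x p.1 p.2.1 p.2.2)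
      (fun p : Fin 3 × J × Fin 3 => w p.1 p.2.1 p.2.2))) :
    4 * Fintype.card Q + Fintype.card J ≤ Fintype.card E + 11 := by
  obtain ⟨c, hc⟩ := exists_cameras_mem_algSpan k hC
  choose μ hμ using hx
  choose α β hαβ using hw
  let g : ((Q × Fin 3) ⊕ (J × Fin 3)) ⊕ ((E ⊕ J) ⊕ ((Fin 2 × Q) ⊕
      (((Fin 2 × J) ⊕ (Fin 2 × J)) ⊕ Fin 11))) → ℂ :=
    Sum.elim (Sum.elim (fun p => x 0 p.1 p.2) (fun p => w 0 p.1 p.2))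
      (Sum.elim (Sum.elim d (fun j => ω j (Fin.last 3)))
        (Sum.elim (fun p => μ p.1.succ p.2)
          (Sum.elim (Sum.elim (fun p => α p.1.succ p.2) (fun p => β p.1.succ p.2)) c)))
  set K := algSpan k (Set.range g) with hK
  have hg : ∀ c, g c ∈ K := fun c => subset_algSpan k _ ⟨c, rfl⟩
  have hCK : ∀ v a b, C v a b ∈ K := fun v a b => algSpan_mono k
    (by rintro _ ⟨i, rfl⟩; exact ⟨Sum.inr (Sum.inr (Sum.inr (Sum.inr i))), rfl⟩) (hc v a b)
  have h0 : ∀ (Y : Fin 4 → ℂ) a, (C 0 *ᵥ Y) a = Y a.castSucc := by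
    intro Y a
    rw [Camera.mulVec_eq, (hC.2.1 0 rfl).1, (hC.2.1 0 rfl).2]
    simp
  have hXK : ∀ q b, X q b ∈ K := by
    intro q b
    refine Fin.lastCases ?_ (fun a => ?_) b
    · exact algSpan_mono k (by rintro _ ⟨i, rfl⟩; exact ⟨Sum.inr (Sum.inl (Sum.inl i)), rfl⟩) (hd q)
    · rw [← h0 (X q), hX]; exact hg (Sum.inl (Sum.inl (q, a)))
  have hωK : ∀ j b, ω j b ∈ K := by
    intro j b
    refine Fin.lastCases ?_ (fun a => ?_) b
    · exact hg (Sum.inr (Sum.inl (Sum.inr j)))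
    · rw [← h0 (ω j), hω]; exact hg (Sum.inl (Sum.inr (j, a)))
  have hxK : ∀ v q a, x v q a ∈ K := by
    intro v q a
    refine Fin.cases ?_ (fun v => ?_) v
    · exact hg (Sum.inl (Sum.inl (q, a)))
    · rw [hμ]
      exact mul_mem (hg (Sum.inr (Sum.inr (Sum.inl (v, q))))) (mulVec_mem (hCK _) (hXK q) a)
  have hwK : ∀ v j a, w v j a ∈ K := by
    intro v j a
    refine Fin.cases ?_ (fun v => ?_) v
    · exact hg (Sum.inl (Sum.inr (j, a)))
    · rw [hαβ]
      exact add_mem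
        (mul_mem (hg (Sum.inr (Sum.inr (Sum.inr (Sum.inl (Sum.inl (v, j)))))))
          (mulVec_mem (hCK _) (hXK _) a))
        (mul_mem (hg (Sum.inr (Sum.inr (Sum.inr (Sum.inl (Sum.inr (v, j)))))))
          (mulVec_mem (hCK _) (hωK _) a))
  have := card_le_of_algebraicIndependent hind g (by
    rintro (⟨v, q, a⟩ | ⟨v, j, a⟩)
    exacts [hxK v q a, hwK v j a])
  simp only [Fintype.card_sum, Fintype.card_prod, Fintype.card_fin] at this
  omega

/-- The dimension count for three views of a single point that is not at infinity: the directions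
of its pins are seen by the rotations of the cameras alone. -/
lemma card_le_of_views_of_ne_zero {k : Subfield ℂ} {J : Type*} [Fintype J]
    {C : Fin 3 → Camera} (hC : C ∈ cameraConfigs 3)
    {x : Fin 3 → Fin 3 → ℂ} {w : Fin 3 → J → Fin 3 → ℂ}
    {X : Fin 4 → ℂ} {ω : J → Fin 4 → ℂ}
    (hX : C 0 *ᵥ X = x 0) (hω : ∀ j, C 0 *ᵥ ω j = w 0 j)
    (hx : ∀ v, ∃ μ : ℂ, x v = μ • C v *ᵥ X)
    (hw : ∀ v j, ∃ α β : ℂ, w v j = α • C v *ᵥ X + β • C v *ᵥ ω j)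
    (hX0 : X (Fin.last 3) ≠ 0)
    (hind : AlgebraicIndependent k (Sum.elim (fun p : Fin 3 × Fin 3 => x p.1 p.2)
      (fun p : Fin 3 × J × Fin 3 => w p.1 p.2.1 p.2.2))) :
    Fintype.card J ≤ 6 := by
  obtain ⟨g₁, h₁⟩ := exists_orthogonal_mem_algSpan k (hC.1 1).1
  obtain ⟨g₂, h₂⟩ := exists_orthogonal_mem_algSpan k (hC.1 2).1
  choose μ hμ using hx
  choose α β hαβ using hw
  have hμ0 : ∀ v, μ v ≠ 0 := by
    intro v h0
    refine hind.ne_zero (Sum.inl (v, 0)) ?_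
    show x v 0 = 0
    rw [hμ v, h0, zero_smul]; rfl
  have h0 : ∀ (Y : Fin 4 → ℂ) a, (C 0 *ᵥ Y) a = Y a.castSucc := by
    intro Y a
    rw [Camera.mulVec_eq, (hC.2.1 0 rfl).1, (hC.2.1 0 rfl).2]
    simp
  -- replacing `ω j` by `ω j - τ j • X`, a vector at infinity, eliminates the translations
  let τ : J → ℂ := fun j => ω j (Fin.last 3) / X (Fin.last 3)
  let γ : Fin 3 → J → ℂ := fun v j => (α v j + β v j * τ j) / μ v
  have key : ∀ v j, w v j = γ v j • x v + β v j • (C v).rot *ᵥ (w 0 j - τ j • x 0) := by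
    intro v j
    have e1 : C v *ᵥ (ω j - τ j • X) = (C v).rot *ᵥ (w 0 j - τ j • x 0) := by
      rw [Camera.mulVec_eq]
      have : (ω j - τ j • X) (Fin.last 3) = 0 := by
        simp only [τ, Pi.sub_apply, Pi.smul_apply, smul_eq_mul]
        rw [div_mul_cancel₀ _ hX0, sub_self]
      rw [this, zero_smul, add_zero]
      congr 1
      ext a
      simp only [Pi.sub_apply, Pi.smul_apply]
      rw [← h0 (ω j), ← h0 X, hω, hX]
    rw [← e1, hαβ, hμ v, Matrix.mulVec_sub, Matrix.mulVec_smul, smul_smul,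
      div_mul_cancel₀ _ (hμ0 v), smul_sub, smul_smul, add_smul]
    abel
  let g : ((Fin 3 × Fin 3) ⊕ (J × Fin 3)) ⊕ (J ⊕
      (((Fin 2 × J) ⊕ (Fin 2 × J)) ⊕ (Fin 3 ⊕ Fin 3))) → ℂ :=
    Sum.elim (Sum.elim (fun p => x p.1 p.2) (fun p => w 0 p.1 p.2))
      (Sum.elim τ
        (Sum.elim (Sum.elim (fun p => γ p.1.succ p.2) (fun p => β p.1.succ p.2))
          (Sum.elim g₁ g₂)))
  set K := algSpan k (Set.range g) with hK
  have hg : ∀ c, g c ∈ K := fun c => subset_algSpan k _ ⟨c, rfl⟩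
  have hrot : ∀ (v : Fin 2) a b, (C v.succ).rot a b ∈ K := by
    intro v a b
    fin_cases v
    · exact algSpan_mono k (by
        rintro _ ⟨i, rfl⟩; exact ⟨Sum.inr (Sum.inr (Sum.inr (Sum.inl i))), rfl⟩) (h₁ a b)
    · exact algSpan_mono k (by
        rintro _ ⟨i, rfl⟩; exact ⟨Sum.inr (Sum.inr (Sum.inr (Sum.inr i))), rfl⟩) (h₂ a b)
  have hxK : ∀ v a, x v a ∈ K := fun v a => hg (Sum.inl (Sum.inl (v, a)))
  have hw0 : ∀ j a, w 0 j a ∈ K := fun j a => hg (Sum.inl (Sum.inr (j, a)))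
  have hwK : ∀ v j a, w v j a ∈ K := by
    intro v j a
    refine Fin.cases (hw0 j a) (fun v => ?_) v
    rw [key]
    exact add_mem
      (mul_mem (hg (Sum.inr (Sum.inr (Sum.inl (Sum.inl (v, j)))))) (hxK _ a))
      (mul_mem (hg (Sum.inr (Sum.inr (Sum.inl (Sum.inr (v, j))))))
        (mulVec_mem (hrot v) (fun b => sub_mem (hw0 j b)
          (mul_mem (hg (Sum.inr (Sum.inl j))) (hxK 0 b))) a))
  have := card_le_of_algebraicIndependent hind g (by
    rintro (⟨v, a⟩ | ⟨v, j, a⟩)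
    exacts [hxK v a, hwK v j a])
  simp only [Fintype.card_sum, Fintype.card_prod, Fintype.card_fin] at this
  omega

/-! ### Points with many pins -/

namespace PointLineProblem

variable {P L : Type*} {D : PointLineProblem P L 3}

/-- The homogeneous coordinates of a point in space can be scaled such that the first camera, a
coordinate projection, maps them exactly to given coordinates of its image. -/
lemma exists_point_lift {F : Frame 3 D.ObsPt D.ObsLn} {S : Configuration P L 3}
    (hS : S ∈ D.solutions F.toArrangement) {i : P} (hi : ∀ v, i ∈ D.obsPt v) :
    ∃ X : Fin 4 → ℂ, X ∈ (S.arr.point i).submodule ∧ S.cam 0 *ᵥ X = F.pt ⟨(0, i), hi 0⟩ ∧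
      ∀ v, ∃ μ : ℂ, F.pt ⟨(v, i), hi v⟩ = μ • S.cam v *ᵥ X := by
  have h1 : ∀ v, ∃ r : ℂ, r • S.cam v *ᵥ (S.arr.point i).rep = F.pt ⟨(v, i), hi v⟩ := by
    intro v
    have h2 : (S.arr.point i).submodule.map (S.cam v).mulVecLin
        = Projectivization.submodule (Projectivization.mk ℂ _ _) := hS.2.1 ⟨(v, i), hi v⟩
    rw [Projectivization.submodule_mk, Projectivization.submodule_eq, Submodule.map_span,
      Set.image_singleton] at h2
    rw [← Submodule.mem_span_singleton]
    exact h2.symm ▸ Submodule.mem_span_singleton_self _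
  choose r hr using h1
  have h0 : r 0 ≠ 0 := fun h => F.pt_ne ⟨(0, i), hi 0⟩ (by rw [← hr, h, zero_smul])
  refine ⟨r 0 • (S.arr.point i).rep, Submodule.smul_mem _ _ (rep_mem _), ?_, fun v => ?_⟩
  · rw [Matrix.mulVec_smul, hr]
  · refine ⟨r v / r 0, ?_⟩
    rw [Matrix.mulVec_smul, smul_smul, div_mul_cancel₀ _ h0, hr]

/-- Like a point, a second vector on a pin can be chosen with given coordinates of its image in the
first view. -/
lemma exists_pin_lift {F : Frame 3 D.ObsPt D.ObsLn}
    (hF : ∀ (a : D.ObsPt) (b : D.ObsLn), a.1.1 = b.1.1 ∧ D.inc a.1.2 b.1.2 → F.ln b 0 = F.pt a)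
    {S : Configuration P L 3} (hS : S ∈ D.solutions F.toArrangement) {i : P} {j : L}
    (hij : D.inc i j) (hi : ∀ v, i ∈ D.obsPt v) (hj : ∀ v, j ∈ D.obsLn v) {X : Fin 4 → ℂ}
    (hX : X ∈ (S.arr.point i).submodule) (hX0 : S.cam 0 *ᵥ X = F.pt ⟨(0, i), hi 0⟩) :
    ∃ ω : Fin 4 → ℂ, S.cam 0 *ᵥ ω = F.ln ⟨(0, j), hj 0⟩ 1 ∧
      ∀ v, ∃ α β : ℂ, F.ln ⟨(v, j), hj v⟩ 1 = α • S.cam v *ᵥ X + β • S.cam v *ᵥ ω := by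
  have hmap : ∀ v, (S.arr.line j).1.map (S.cam v).mulVecLin =
      Submodule.span ℂ (Set.range (F.ln ⟨(v, j), hj v⟩)) := fun v => hS.2.2 ⟨(v, j), hj v⟩
  have hln : ∀ v, F.ln ⟨(v, j), hj v⟩ 1 ∈ (S.arr.line j).1.map (S.cam v).mulVecLin := fun v => by
    rw [hmap]; exact Submodule.subset_span ⟨1, rfl⟩
  obtain ⟨ω, hωW, hω⟩ := hln 0
  refine ⟨ω, hω, fun v => ?_⟩
  have hind : LinearIndependent ℂ ![X, ω] := by
    refine LinearIndependent.of_comp (S.cam 0).mulVecLin ?_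
    convert F.ln_indep ⟨(0, j), hj 0⟩ using 1
    ext a
    fin_cases a
    · exact congrFun (hX0.trans (hF ⟨(0, i), hi 0⟩ ⟨(0, j), hj 0⟩ ⟨rfl, hij⟩).symm) _
    · exact congrFun hω _
  have hW := eq_span_pair (S.arr.line j).2 (hS.1.1 i j hij hX) hωW hind
  have := hln v
  rw [hW, Submodule.map_span, Set.image_insert_eq, Set.image_singleton] at this
  obtain ⟨α, β, h⟩ := Submodule.mem_span_pair.1 this
  exact ⟨α, β, h.symm⟩

/-- Points `I` and pins `Jp`, all seen in all three views, in a problem with a dominant joint camera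
map: there is a solution for an image in which the coordinates of their images are algebraically
independent. -/
lemma exists_generic_views [Finite P] [Finite L] (hD : D.IsPL1P)
    (hmin : Generic D.imageVariety fun y => (D.solutions y).Nonempty)
    {Q J : Type*} (I : Q → P) (hI : Function.Injective I) (Jp : J → L)
    (hJ : Function.Injective Jp) (π : J → Q) (hinc : ∀ j, D.inc (I (π j)) (Jp j))
    (hi : ∀ q v, I q ∈ D.obsPt v) (hj : ∀ j v, Jp j ∈ D.obsLn v) :
    ∃ (k : Subfield ℂ) (C : Fin 3 → Camera) (x : Fin 3 → Q → Fin 3 → ℂ)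
      (w : Fin 3 → J → Fin 3 → ℂ) (X : Q → Fin 4 → ℂ) (ω : J → Fin 4 → ℂ),
      C ∈ cameraConfigs 3 ∧ (∀ q, C 0 *ᵥ X q = x 0 q) ∧ (∀ j, C 0 *ᵥ ω j = w 0 j) ∧
      (∀ v q, ∃ μ : ℂ, x v q = μ • C v *ᵥ X q) ∧
      (∀ v j, ∃ α β : ℂ, w v j = α • C v *ᵥ X (π j) + β • C v *ᵥ ω j) ∧
      AlgebraicIndependent k (Sum.elim (fun p : Fin 3 × Q × Fin 3 => x p.1 p.2.1 p.2.2)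
        (fun p : Fin 3 × J × Fin 3 => w p.1 p.2.1 p.2.2)) := by
  obtain ⟨k, z, F, hz, hFp, hFl, hF, S, hS⟩ :=
    hmin.exists_algebraicIndependent hD.imageInc D.imageVariety_nonempty
  choose X hX hX0 hμ using fun q => exists_point_lift hS (hi q)
  choose ω hω hαβ using fun j =>
    exists_pin_lift hF hS (hinc j) (hi (π j)) (hj j) (hX (π j)) (hX0 (π j))
  refine ⟨k, S.cam, fun v q => F.pt ⟨(v, I q), hi q v⟩, fun v j => F.ln ⟨(v, Jp j), hj j v⟩ 1,
    X, ω, hS.1.2, hX0, hω, fun v q => hμ q v, fun v j => hαβ j v, ?_⟩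
  let r : (Fin 3 × Q × Fin 3) ⊕ (Fin 3 × J × Fin 3) →
      (D.ObsPt × Fin 3) ⊕ (D.ObsLn × Fin 2 × Fin 3) :=
    Sum.elim (fun p => Sum.inl (⟨(p.1, I p.2.1), hi p.2.1 p.1⟩, p.2.2))
      (fun p => Sum.inr (⟨(p.1, Jp p.2.1), hj p.2.1 p.1⟩, 1, p.2.2))
  have hr : Function.Injective r := by
    rintro (⟨v, q, a⟩ | ⟨v, q, a⟩) (⟨v', q', a'⟩ | ⟨v', q', a'⟩) h
    · simp only [r, Sum.elim_inl, Sum.inl.injEq, Prod.mk.injEq, Subtype.mk.injEq] at h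
      obtain ⟨⟨rfl, hq⟩, rfl⟩ := h
      rw [hI hq]
    · simp [r] at h
    · simp [r] at h
    · simp only [r, Sum.elim_inr, Sum.inr.injEq, Prod.mk.injEq, Subtype.mk.injEq, true_and] at h
      obtain ⟨⟨rfl, hq⟩, rfl⟩ := h
      rw [hJ hq]
  convert hz.comp r hr using 1
  ext (⟨v, q, a⟩ | ⟨v, q, a⟩)
  exacts [hFp _ a, hFl _ a]

/-- A point seen with all its pins in three views has at most seven pins. -/
lemma ncard_pins_le [Finite P] [Finite L] (hD : D.IsPL1P)
    (hmin : Generic D.imageVariety fun y => (D.solutions y).Nonempty) {i : P}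
    (hi : ∀ v, i ∈ D.obsPt v) (hj : ∀ j ∈ D.pins i, ∀ v, j ∈ D.obsLn v) :
    (D.pins i).ncard ≤ 7 := by
  have := Fintype.ofFinite (D.pins i)
  obtain ⟨k, C, x, w, X, ω, hC, hX, hω, hx, hw, hind⟩ := exists_generic_views hD hmin
    (fun _ : Unit => i) (fun _ _ _ => rfl) (fun j : D.pins i => j.1) Subtype.val_injective
    (fun _ => ()) (fun j => j.2) (fun _ => hi) (fun j => hj j.1 j.2)
  rw [← Nat.card_coe_set_eq, Nat.card_eq_fintype_card]
  -- a point at infinity has no free depth, hence the empty index type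
  by_cases h0 : X () (Fin.last 3) = 0
  · have := card_le_of_views _ hC hX hω hx hw (E := Empty) Empty.elim
      (fun q => by rw [h0]; exact zero_mem _) hind
    simp only [Fintype.card_unit, Fintype.card_empty] at this
    omega
  · have hr : Function.Injective (Sum.map (fun p : Fin 3 × Fin 3 => (p.1, (), p.2))
        (id : Fin 3 × D.pins i × Fin 3 → _)) :=
      Function.Injective.sumMap (fun p q h => by
        simp only [Prod.mk.injEq, true_and] at h
        exact Prod.ext h.1 h.2) Function.injective_id
    have := card_le_of_views_of_ne_zero hC (hX ()) hω (fun v => hx v ()) hw h0 (by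
      convert hind.comp _ hr using 1
      ext (p | p) <;> rfl)
    omega

/-- Two points seen with all their pins in three views do not both have three pins. -/
lemma eq_of_three_le_ncard_pins [Finite P] [Finite L] (hD : D.IsPL1P)
    (hmin : Generic D.imageVariety fun y => (D.solutions y).Nonempty) {i i' : P}
    (hi : ∀ v, i ∈ D.obsPt v) (hj : ∀ j ∈ D.pins i, ∀ v, j ∈ D.obsLn v)
    (hi' : ∀ v, i' ∈ D.obsPt v) (hj' : ∀ j ∈ D.pins i', ∀ v, j ∈ D.obsLn v)
    (h3 : 3 ≤ (D.pins i).ncard) (h3' : 3 ≤ (D.pins i').ncard) : i = i' := by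
  by_contra hne
  have := Fintype.ofFinite (D.pins i)
  have := Fintype.ofFinite (D.pins i')
  obtain ⟨k, C, x, w, X, ω, hC, hX, hω, hx, hw, hind⟩ := exists_generic_views hD hmin
    (fun b : Bool => if b then i else i') (by
      rintro (_ | _) (_ | _) h
      exacts [rfl, absurd h.symm hne, absurd h hne, rfl])
    (Sum.elim (fun j : D.pins i => j.1) (fun j : D.pins i' => j.1)) (by
      refine Subtype.val_injective.sumElim Subtype.val_injective fun a b h => hne ?_
      exact hD i i' a.1 a.2 (h ▸ b.2))
    (Sum.elim (fun _ => true) (fun _ => false)) (by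
      rintro (j | j)
      exacts [j.2, j.2])
    (by
      rintro (_ | _)
      exacts [hi', hi]) (by
      rintro (j | j)
      exacts [hj j.1 j.2, hj' j.1 j.2])
  have := card_le_of_views _ hC hX hω hx hw (fun q => X q (Fin.last 3))
      (fun q => subset_algSpan k _ ⟨q, rfl⟩) hind
  rw [← Nat.card_coe_set_eq, Nat.card_eq_fintype_card] at h3 h3'
  simp only [Fintype.card_bool, Fintype.card_sum] at this
  omega

end PointLineProblem

/-! ### The reduced minimal problems -/

lemma exists_third (a b : Fin 3) (h : a ≠ b) :
    ∃ c, c ≠ a ∧ c ≠ b ∧ ∀ v, v = a ∨ v = b ∨ v = c := by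
  revert a b; decide

lemma exists_other (c : Fin 3) : ∃ a, a ≠ c := by
  revert c; decide

/-- Views `a`, `b`, `c` in a given order. -/
lemma exists_perm (a b c : Fin 3) (hab : a ≠ b) (hac : a ≠ c) (hbc : b ≠ c) :
    ∃ σ : Equiv.Perm (Fin 3), σ 0 = a ∧ σ 1 = b ∧ σ 2 = c := by
  revert a b c; decide

/-- A set of views which has two elements misses at most one view. -/
lemma forall_mem_or_exists_iff_ne {p : Fin 3 → Prop} (h : ∀ v₀, ∃ v, p v ∧ v ≠ v₀) :
    (∀ v, p v) ∨ ∃ c, ∀ v, p v ↔ v ≠ c := by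
  by_cases hall : ∀ v, p v
  · exact Or.inl hall
  · push Not at hall
    obtain ⟨c, hc⟩ := hall
    refine Or.inr ⟨c, fun v => ⟨fun hv h => hc (h ▸ hv), fun hv => ?_⟩⟩
    obtain ⟨u, huc, huv, hu⟩ := exists_third c v hv.symm
    obtain ⟨w, hw, hwu⟩ := h u
    rcases hu w with rfl | rfl | rfl
    exacts [absurd hw hc, hw, absurd rfl hwu]

namespace PointLineProblem

variable {P L : Type*} {D : PointLineProblem P L 3}

lemma exists_obsLn_ne (hD : D.IsPL1P) (hmin : D.IsMinimal) (j : L) (v₀ : Fin 3) :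
    ∃ v, j ∈ D.obsLn v ∧ v ≠ v₀ := by
  by_contra! h
  obtain ⟨y, -, hne, hfin⟩ := hmin.1.exists_and hmin.2 D.imageVariety_nonempty
  exact D.infinite_solutions_of_line hD hne j v₀ h hfin

lemma exists_obsPt_ne (hmin : D.IsMinimal) {i : P} (hi : D.pins i = ∅) (v₀ : Fin 3) :
    ∃ v, i ∈ D.obsPt v ∧ v ≠ v₀ := by
  by_contra! h
  obtain ⟨y, -, hne, hfin⟩ := hmin.1.exists_and hmin.2 D.imageVariety_nonempty
  exact D.infinite_solutions_of_point hne i (fun j hj => (hi ▸ hj : j ∈ (∅ : Set L))) v₀ h hfin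

/-- In a reduced minimal problem, a line is seen in all views, or in all but one; in the latter
case it has a point that is not seen in one of the views of the line. -/
lemma line_cases [Finite L] (hD : D.IsPL1P) (hmin : D.IsMinimal) (hred : D.IsReduced) (j : L) :
    (∀ v, j ∈ D.obsLn v) ∨ ∃ c, (∀ v, j ∈ D.obsLn v ↔ v ≠ c) ∧
      ∃ i, D.inc i j ∧ ∃ v, v ≠ c ∧ i ∉ D.obsPt v := by
  refine (forall_mem_or_exists_iff_ne (exists_obsLn_ne hD hmin j)).imp_right ?_
  rintro ⟨c, hc⟩
  refine ⟨c, hc, ?_⟩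
  by_contra! h
  obtain ⟨a, hac⟩ : ∃ a, a ≠ c := exists_other c
  obtain ⟨b, hba, hbc, hb⟩ := exists_third a c hac
  have := (hred _ _ (D.reducibleTo_of_line hD hba.symm (fun v => ?_)
    (fun i hi => ⟨h i hi a hac, h i hi b hbc⟩))).2
  · exact (this ▸ Set.mem_univ j : j ∈ ({j}ᶜ : Set L)) rfl
  · rw [hc]
    constructor
    · intro hv
      rcases hb v with h | h | h
      exacts [Or.inl h, absurd h hv, Or.inr h]
    · rintro (rfl | rfl)
      exacts [hac, hbc]

/-- Of two pins of a point, one that is seen in all views forces the other to be seen in all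
views. -/
lemma pin_seen_of_pin_seen [Finite L] (hD : D.IsPL1P) (hmin : D.IsMinimal)
    (hred : D.IsReduced) {i : P} {j k : L} (hjk : j ≠ k) (hj : D.inc i j)
    (hk : D.inc i k) (h : ∀ v, j ∈ D.obsLn v) :
    ∀ v, k ∈ D.obsLn v := by
  refine (line_cases hD hmin hred k).resolve_right ?_
  rintro ⟨c, hc, i', hi', v, hv, hiv⟩
  obtain rfl := hD i i' k hk hi'
  exact hiv (D.obs_meet v i j k hjk hj hk (h v) ((hc v).2 hv))

/-- If a pin of a point is not seen in the view `c`, then another view sees the pin but not the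
point. -/
lemma pin_cases [Finite L] (hD : D.IsPL1P) (hmin : D.IsMinimal) (hred : D.IsReduced) {i : P} {j : L}
    (hj : D.inc i j) : (∀ v, j ∈ D.obsLn v) ∨ ∃ c, (∀ v, j ∈ D.obsLn v ↔ v ≠ c) ∧
      ∃ v, v ≠ c ∧ i ∉ D.obsPt v := by
  refine (line_cases hD hmin hred j).imp_right ?_
  rintro ⟨c, hc, i', hi', h⟩
  obtain rfl := hD i i' j hj hi'
  exact ⟨c, hc, h⟩

/-- If two pins are missing in one view each, `c` and `c'`, and each of them is seen somewhere
without the point, then `c` and `c'` are different and are the views where this happens. -/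
lemma two_pins_cases {i : P} {j k : L} (hjk : j ≠ k) (hj : D.inc i j) (hk : D.inc i k)
    {c c' : Fin 3} (hc : ∀ v, j ∈ D.obsLn v ↔ v ≠ c) (hc' : ∀ v, k ∈ D.obsLn v ↔ v ≠ c')
    (h : ∃ v, v ≠ c ∧ i ∉ D.obsPt v) (h' : ∃ v, v ≠ c' ∧ i ∉ D.obsPt v) :
    c ≠ c' ∧ i ∉ D.obsPt c ∧ i ∉ D.obsPt c' := by
  have hm : ∀ v, v ≠ c → v ≠ c' → i ∈ D.obsPt v := fun v h1 h2 =>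
    D.obs_meet v i j k hjk hj hk ((hc v).2 h1) ((hc' v).2 h2)
  obtain ⟨v, hv, hiv⟩ := h
  obtain ⟨v', hv', hiv'⟩ := h'
  obtain rfl : v = c' := by by_contra h; exact hiv (hm v hv h)
  obtain rfl : v' = c := by by_contra h; exact hiv' (hm v' h hv')
  exact ⟨hv', hiv', hiv⟩

lemma seen_of_three_le_ncard_pins [Finite L] (hD : D.IsPL1P) (hmin : D.IsMinimal)
    (hred : D.IsReduced) {i : P} (h3 : 3 ≤ (D.pins i).ncard) :
    ∀ v, i ∈ D.obsPt v ∧ ∀ j ∈ D.pins i, j ∈ D.obsLn v := by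
  obtain ⟨a, b, d, ha, hb, hd, hab, had, hbd⟩ := (Set.two_lt_ncard_iff).1 h3
  have hall : ∀ j ∈ D.pins i, (∀ v, j ∈ D.obsLn v) → ∀ v, i ∈ D.obsPt v ∧
      ∀ j ∈ D.pins i, j ∈ D.obsLn v := by
    intro j hj hjv
    have hpins : ∀ k ∈ D.pins i, ∀ v, k ∈ D.obsLn v := by
      intro k hk
      by_cases hjk : j = k
      · exact hjk ▸ hjv
      · exact pin_seen_of_pin_seen hD hmin hred hjk hj hk hjv
    exact fun v => ⟨D.obs_meet v i a b hab ha hb (hpins a ha v) (hpins b hb v),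
      fun k hk => hpins k hk v⟩
  rcases pin_cases hD hmin hred ha with h | ⟨ca, hca, hva⟩
  · exact hall a ha h
  rcases pin_cases hD hmin hred hb with h | ⟨cb, hcb, hvb⟩
  · exact hall b hb h
  rcases pin_cases hD hmin hred hd with h | ⟨cd, hcd, hvd⟩
  · exact hall d hd h
  -- the three pins are missing in three different views, so two of them are seen in the view
  -- `cd`, which does not see the point
  exfalso
  have h1 := two_pins_cases hab ha hb hca hcb hva hvb
  have h2 := two_pins_cases had ha hd hca hcd hva hvd
  have h3 := two_pins_cases hbd hb hd hcb hcd hvb hvd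
  exact h3.2.2 (D.obs_meet cd i a b hab ha hb ((hca cd).2 h2.1.symm) ((hcb cd).2 h3.1.symm))

end PointLineProblem

end PLP

end

theorem theorem3 {P L : Type*} [Finite P] [Finite L] (D : PLP.PointLineProblem P L 3)
    (hD : D.IsPL1P) (hmin : D.IsMinimal) (hred : D.IsReduced) :
    -- at most one point with three or more pins
    (∀ i i', 3 ≤ (D.pins i).ncard → 3 ≤ (D.pins i').ncard → i = i') ∧
    -- it has at most seven pins, and everything is seen in all views
    (∀ i, 3 ≤ (D.pins i).ncard →
      (D.pins i).ncard ≤ 7 ∧ ∀ v, i ∈ D.obsPt v ∧ ∀ j ∈ D.pins i, j ∈ D.obsLn v) ∧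
    -- points with two pins
    (∀ i j k, j ≠ k → D.pins i = {j, k} →
      ∃ T ∈ PLP.table2, ∃ σ : Equiv.Perm (Fin 3), ∀ v,
        (i ∈ D.obsPt (σ v) ↔ (T v).1 = true) ∧
        (j ∈ D.obsLn (σ v) ↔ (T v).2.1 = true) ∧
        (k ∈ D.obsLn (σ v) ↔ (T v).2.2 = true)) ∧
    -- points with one pin
    (∀ i j, D.pins i = {j} →
      ∃ T ∈ PLP.table1, ∃ σ : Equiv.Perm (Fin 3), ∀ v,
        (i ∈ D.obsPt (σ v) ↔ (T v).1 = true) ∧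
        (j ∈ D.obsLn (σ v) ↔ (T v).2 = true)) ∧
    -- points without pins
    (∀ i, D.pins i = ∅ →
      ∃ T ∈ PLP.table0, ∃ σ : Equiv.Perm (Fin 3), ∀ v,
        (i ∈ D.obsPt (σ v) ↔ T v = true)) ∧
    -- free lines
    (∀ j, D.IsFreeLine j → ∀ v, j ∈ D.obsLn v) := by
  open PLP PLP.PointLineProblem in
  refine ⟨fun i i' h3 h3' => ?_, fun i h3 => ?_, fun i j k hjk hi => ?_, fun i j hi => ?_,
    fun i hi => ?_, fun j hj => ?_⟩
  · have h := seen_of_three_le_ncard_pins hD hmin hred h3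
    have h' := seen_of_three_le_ncard_pins hD hmin hred h3'
    exact eq_of_three_le_ncard_pins hD hmin.1 (fun v => (h v).1) (fun j hj v => (h v).2 j hj)
      (fun v => (h' v).1) (fun j hj v => (h' v).2 j hj) h3 h3'
  · have h := seen_of_three_le_ncard_pins hD hmin hred h3
    exact ⟨ncard_pins_le hD hmin.1 (fun v => (h v).1) (fun j hj v => (h v).2 j hj), h⟩
  · have hj : D.inc i j := (hi ▸ Set.mem_insert j {k} : j ∈ D.pins i)
    have hk : D.inc i k := (hi ▸ Set.mem_insert_of_mem j rfl : k ∈ D.pins i)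
    have hall : (∀ v, j ∈ D.obsLn v) → (∀ v, k ∈ D.obsLn v) →
        ∃ T ∈ table2, ∃ σ : Equiv.Perm (Fin 3), ∀ v,
        (i ∈ D.obsPt (σ v) ↔ (T v).1 = true) ∧
        (j ∈ D.obsLn (σ v) ↔ (T v).2.1 = true) ∧
        (k ∈ D.obsLn (σ v) ↔ (T v).2.2 = true) := by
      intro h h'
      refine ⟨_, List.mem_cons_self, 1, fun v => ?_⟩
      have := D.obs_meet v i j k hjk hj hk (h v) (h' v)
      fin_cases v <;> simp_all
    rcases pin_cases hD hmin hred hj with h | ⟨c, hc, hv⟩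
    · exact hall h (pin_seen_of_pin_seen hD hmin hred hjk hj hk h)
    rcases pin_cases hD hmin hred hk with h | ⟨c', hc', hv'⟩
    · exact hall (pin_seen_of_pin_seen hD hmin hred hjk.symm hk hj h) h
    obtain ⟨hcc, hic, hic'⟩ := two_pins_cases hjk hj hk hc hc' hv hv'
    obtain ⟨u, huc, huc', -⟩ := exists_third c c' hcc
    have hiu := D.obs_meet u i j k hjk hj hk ((hc u).2 huc) ((hc' u).2 huc')
    obtain ⟨σ, h0, h1, h2⟩ := exists_perm u c' c huc' huc hcc.symm
    refine ⟨_, List.mem_cons_of_mem _ List.mem_cons_self, σ, fun v => ?_⟩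
    fin_cases v <;> simp [h0, h1, h2, hc, hc', hiu, hic, hic', huc, huc', hcc, hcc.symm]
  · have hj : D.inc i j := (hi ▸ Set.mem_singleton j : j ∈ D.pins i)
    have hpt : ¬ ((∀ v v', i ∈ D.obsPt v → i ∈ D.obsPt v' → v = v') ∧
        ∀ v, i ∈ D.obsPt v → j ∈ D.obsLn v) := by
      rintro ⟨h1, h2⟩
      have := (hred _ _ (D.reducibleTo_of_point hi h1 h2)).1
      exact (this ▸ Set.mem_univ i : i ∈ ({i}ᶜ : Set P)) rfl
    rcases pin_cases hD hmin hred hj with h | ⟨c, hc, v, hv, hiv⟩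
    · have h2 : ∀ v₀, ∃ v, i ∈ D.obsPt v ∧ v ≠ v₀ := by
        intro v₀
        by_contra! hcon
        exact hpt ⟨fun v v' hv hv' => (hcon v hv).trans (hcon v' hv').symm, fun v _ => h v⟩
      rcases forall_mem_or_exists_iff_ne h2 with h' | ⟨c, hc⟩
      · refine ⟨_, List.mem_cons_self, 1, fun v => ?_⟩
        fin_cases v <;> simp [h, h']
      · obtain ⟨a, hac⟩ : ∃ a, a ≠ c := exists_other c
        obtain ⟨b, hba, hbc, -⟩ := exists_third a c hac
        obtain ⟨σ, h0, h1, h2⟩ := exists_perm a b c hba.symm hac hbc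
        refine ⟨_, List.mem_cons_of_mem _ List.mem_cons_self, σ, fun v => ?_⟩
        fin_cases v <;> simp [h0, h1, h2, hc, h, hac, hbc]
    · obtain ⟨u, huv, huc, hu⟩ := exists_third v c hv
      have hic : i ∈ D.obsPt c := by
        by_contra hic
        have key : ∀ w, i ∈ D.obsPt w → w = u := by
          intro w hw
          rcases hu w with rfl | rfl | rfl
          exacts [absurd hw hiv, absurd hw hic, rfl]
        exact hpt ⟨fun w w' hw hw' => (key w hw).trans (key w' hw').symm,
          fun w hw => (hc w).2 (key w hw ▸ huc)⟩
      obtain ⟨σ, h0, h1, h2⟩ := exists_perm c u v huc.symm hv.symm huv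
      by_cases hiu : i ∈ D.obsPt u
      · refine ⟨_, List.mem_cons_of_mem _ (List.mem_cons_of_mem _ List.mem_cons_self), σ,
          fun w => ?_⟩
        fin_cases w <;> simp [h0, h1, h2, hc, hic, hiu, hiv, huc, hv]
      · refine ⟨_, List.mem_cons_of_mem _ (List.mem_cons_of_mem _ (List.mem_cons_of_mem _
          List.mem_cons_self)), σ, fun w => ?_⟩
        fin_cases w <;> simp [h0, h1, h2, hc, hic, hiu, hiv, huc, hv]
  · rcases forall_mem_or_exists_iff_ne (exists_obsPt_ne hmin hi) with h' | ⟨c, hc⟩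
    · refine ⟨_, List.mem_cons_self, 1, fun v => ?_⟩
      fin_cases v <;> simp [h']
    · obtain ⟨a, hac⟩ : ∃ a, a ≠ c := exists_other c
      obtain ⟨b, hba, hbc, -⟩ := exists_third a c hac
      obtain ⟨σ, h0, h1, h2⟩ := exists_perm a b c hba.symm hac hbc
      refine ⟨_, List.mem_cons_of_mem _ List.mem_cons_self, σ, fun v => ?_⟩
      fin_cases v <;> simp [h0, h1, h2, hc, hac, hbc]
  · refine (line_cases hD hmin hred j).resolve_right ?_
    rintro ⟨c, -, i, hi, -⟩
    exact hj i hi
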